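/- Let $G$ be the group of monotone bijections of $\mathbb{Q}$ (the total order symmetry). A set $X$ with a $G$-action is an orbit-finite nominal set if each $x\in X$ has a finite support (a finite $C\subset\mathbb{Q}$ such that every $g\in G$ fixing $C$ pointwise fixes $x$) and $X$ has finitely many orbits; $N(X)$ is the number of orbits, and $\dim(X)$ is the maximal size of the least support of an element of $X$ ($0$ if $X=\emptyset$). A nominal DFA $(S,A,F,\delta)$ consists of orbit-finite nominal sets $S$ (states) and $A$ (symbols), an equivariant subset $F\subseteq S$ and an equivariant map $\delta\colon S\times A\to S$. Put $k=\dim(S\cup A)=\max(\dim S,\dim A)$. Moore's algorithm computes $\equiv_{-1}=S\times S$, $\equiv_0=\{(q_1,q_2)\mid q_1\in F\Leftrightarrow q_2\in F\}$ and, while $\equiv_i\neq\equiv_{i-1}$, the relation $\equiv_{i+1}=\{(q_1,q_2)\in{\equiv_i}\mid \forall a\in A,\ (\delta(q_1,a),\delta(q_2,a))\in{\equiv_i}\}$; after the loop it returns $(E,A,F_E,\delta_E)$ with $E=S/{\equiv_i}$, $F_E=\{e\in E\mid e\subseteq F\}$ and $\delta_E(e,a)=e'$ whenever $s\in e$ and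 $\delta(s,a)\in e'$. Equivariant sets are stored as lists of orbits. Time is counted in steps, where each of the following takes one step: comparing two orbits; constructing the orbit of an element; producing an element of an orbit (a sample, or the one with a given least support); reading off the dimension of an orbit; one invocation of an external function or predicate on an element, namely of $\delta$, of $s\in F$, of $e\subseteq F$ for a class $e$, of the predicate "is in $\equiv_i$" used in the filtering, and the choice of a member of a class; and each elementary list operation. The orbits of a product $X\times Y$ are generated by enumerating, for each pair of orbits of dimensions $i$ and $j$, the strings over $\{L,R,B\}$ with $i$ letters in $\{L,B\}$ and $j$ letters in $\{R,B\}$; the line of the loop computes the product of $\equiv_i$ with $A$ in this way and checks each of its orbits; the class of a state is assembled by a scan of the orbits of $\equiv_i$. 1. There is a constant $C$ such that on every nominal DFA $(S,A,F,\delta)$, with $S$ and $A$ given by arbitrary repetition-free lists of their orbits, Moore's algorithm terminates, its final relation is language equivalence of states and its output is the quotient of the automaton by language equivalence (the minimal automaton), and the number of steps is at most $$C\cdot 3^{5k}\,\max(1,k)\,\max(1,N(S))^3\,\max(1,N(A)),$$ that is, $O(3^{5k}\,k\,N(S)^3N(A))$ when $k$, $N(S)$ and $N(A)$ are positive. 2.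 There is a constant $C$ such that for every orbit-finite nominal set $S$, every chain (under refinement) of equivariant partitions of $S$ has at most $C\cdot\max(1,\dim S)\cdot\max(1,N(S))$ members. 3. Hence minimisation is fixed-parameter tractable in the dimension: there are a computable $f\colon\mathbb{N}\to\mathbb{N}$ and a $d\in\mathbb{N}$ such that on every nominal DFA Moore's algorithm terminates with the minimal automaton within $f(k)\cdot(N(S)+N(A)+1)^d$ steps. -/

import Mathlib

open scoped Pointwise

namespace NominalMoore

noncomputable section

universe u v w

/-! ## Nominal sets over the total order symmetry -/

/-- The group of the total order symmetry: monotone bijections of `ℚ`. Multiplication in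
`ℚ ≃o ℚ` is composition `g * h = g ∘ h`, so a left action of this group is the same thing as a
right action of the group with multiplication `f · g = g ∘ f`. -/
abbrev Mon : Type := ℚ ≃o ℚ

/-- The set of orbits of a `Mon`-set. -/
abbrev Orb (X : Type u) [MulAction Mon X] : Type u := MulAction.orbitRel.Quotient Mon X

/-- The orbit of an element. -/
def orb {X : Type u} [MulAction Mon X] (x : X) : Orb X := Quotient.mk (MulAction.orbitRel Mon X) x

/-- The number of orbits. -/
def numOrb (X : Type u) [MulAction Mon X] : ℕ := Nat.card (Orb X)

/-- A finite set `C` of rationals supports `x`: every monotone bijection that fixes `C` pointwise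
fixes `x`. -/
def IsSupport {X : Type u} [MulAction Mon X] (C : Finset ℚ) (x : X) : Prop :=
  ∀ g : Mon, (∀ q ∈ C, g q = q) → g • x = x

/-- `X` is a nominal set (every element has a finite support) with finitely many orbits. -/
structure OrbitFiniteNominal (X : Type u) [MulAction Mon X] : Prop where
  nominal : ∀ x : X, ∃ C : Finset ℚ, IsSupport C x
  orbitFinite : Finite (Orb X)

/-- The least support of `x`, as the intersection of all finite supports. (The total order
symmetry admits least supports: for a finitely supported `x` this set is itself a support.) -/
def leastSupport {X : Type u} [MulAction Mon X] (x : X) : Set ℚ :=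
  {q | ∀ C : Finset ℚ, IsSupport C x → q ∈ C}

/-- The dimension of an element: the size of its least support. -/
def dimElt {X : Type u} [MulAction Mon X] (x : X) : ℕ := (leastSupport x).ncard

/-- The dimension of an orbit-finite nominal set: the maximal dimension of its elements
(`0` for the empty set). -/
def dim (X : Type u) [MulAction Mon X] : ℕ := ⨆ x : X, dimElt x

/-- An equivariant partition of `X`, given by its equivalence relation. -/
def IsEquivariantPartition {X : Type u} [MulAction Mon X] (r : Setoid X) : Prop :=
  ∀ (g : Mon) (x y : X), r x y → r (g • x) (g • y)

/-! ## Nominal deterministic automata -/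

/-- A nominal DFA with states `S`, alphabet `A` (both are required to be orbit-finite nominal sets
wherever this is used), an equivariant set of final states and an equivariant transition
function. -/
structure NominalDFA (S : Type u) (A : Type v) [MulAction Mon S] [MulAction Mon A] where
  final : Set S
  final_equivariant : ∀ (g : Mon) (s : S), s ∈ final → g • s ∈ final
  step : S → A → S
  step_equivariant : ∀ (g : Mon) (s : S) (a : A), step (g • s) (g • a) = g • step s a

namespace NominalDFA

variable {S : Type u} {A : Type v} [MulAction Mon S] [MulAction Mon A]

/-- The set of words accepted from the state `s`. -/
def lang (M : NominalDFA S A) (s : S) : Set (List A) :=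
  {w | w.foldl M.step s ∈ M.final}

/-- The set of states that accept the same language as `s`. -/
def langClass (M : NominalDFA S A) (s : S) : Set S :=
  {t | M.lang t = M.lang s}

end NominalDFA

/-! ## Computations with a step count -/

/-- A value together with the number of steps spent on computing it. -/
structure Timed (α : Type u) where
  val : α
  time : ℕ

namespace Timed

variable {α : Type u} {β : Type v}

/-- A value for free. -/
def ret (a : α) : Timed α := ⟨a, 0⟩

/-- Sequential composition: the steps add up. -/
def bind (x : Timed α) (f : α → Timed β) : Timed β :=
  ⟨(f x.val).val, x.time + (f x.val).time⟩

/-- One step that produces `a`. -/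
def one (a : α) : Timed α := ⟨a, 1⟩

/-- Run `f` on every entry of a list. -/
def map (f : α → Timed β) : List α → Timed (List β)
  | [] => one []
  | a :: l => (f a).bind fun b => (map f l).bind fun r => one (b :: r)

/-- Run `f` on every entry of a list and concatenate the results; copying a result costs one step
per entry. -/
def flatMap (f : α → Timed (List β)) : List α → Timed (List β)
  | [] => one []
  | a :: l => (f a).bind fun b => (flatMap f l).bind fun r => ⟨b ++ r, 1 + b.length⟩

/-- Keep the entries of a list that pass the test `p`. -/
def filter (p : α → Timed Bool) : List α → Timed (List α)
  | [] => one []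
  | a :: l => (p a).bind fun b => (filter p l).bind fun r => one (if b then a :: r else r)

/-- Do all entries of a list pass the test `p`? -/
def all (p : α → Timed Bool) : List α → Timed Bool
  | [] => one true
  | a :: l => (p a).bind fun b => (all p l).bind fun c => one (b && c)

end Timed

/-- Big-step semantics of `while test do body`: started in the first state, the loop halts in the
second state after the given number of steps. -/
inductive WhileRuns {σ : Type u} (test : σ → Timed Bool) (body : σ → Timed σ) : σ → σ → ℕ → Prop
  | done (s : σ) (h : (test s).val = false) : WhileRuns test body s s (test s).time
  | next (s s' : σ) (t : ℕ) (h : (test s).val = true)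
      (hrun : WhileRuns test body (body s).val s' t) :
      WhileRuns test body s s' ((test s).time + (body s).time + t)

/-! ## Elementary operations

Each of these takes one step: the operations on a single orbit, and the invocation of an external
function or predicate on elements. -/

section Elementary

variable {X : Type u} {Y : Type v} [MulAction Mon X]

/-- Construct the orbit of an element. -/
def toOrbit (x : X) : Timed (Orb X) := Timed.one (orb x)

open Classical in
/-- Compare two orbits. -/
def orbEq (o o' : Orb X) : Timed Bool := Timed.one (decide (o = o'))

/-- An element of a given orbit. -/
def sample (o : Orb X) : Timed X := Timed.one (Quotient.out o)

/-- The dimension of a given orbit. -/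
def orbDim (o : Orb X) : Timed ℕ := Timed.one (dimElt (Quotient.out o))

open Classical in
/-- The element of the orbit `o` whose least support is `C` (it exists and is unique if `o` is
an orbit of finitely supported elements of dimension `#C`; otherwise an arbitrary element). -/
def elementAt (o : Orb X) (C : Finset ℚ) : X :=
  if h : ∃ x : X, orb x = o ∧ leastSupport x = ↑C then h.choose else Quotient.out o

/-- Produce the element of a given orbit with a given least support. -/
def getElement (o : Orb X) (C : Finset ℚ) : Timed X := Timed.one (elementAt o C)

/-- Invoke an external function. -/
def call (f : X → Y) (x : X) : Timed Y := Timed.one (f x)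

open Classical in
/-- Invoke an external predicate. -/
def callPred {Z : Type w} (p : Z → Prop) (z : Z) : Timed Bool := Timed.one (decide (p z))

end Elementary

/-! ## Operations on orbit-finite nominal sets

An equivariant orbit-finite subset of `X` is represented by a list of orbits of `X`, in a fixed
order and without repetition. -/

section SetOperations

variable {X : Type u} {Y : Type v} [MulAction Mon X] [MulAction Mon Y]

/-- The list `L` of orbits represents the whole set `X`. -/
def Represents (L : List (Orb X)) : Prop := L.Nodup ∧ ∀ o : Orb X, o ∈ L

/-- Equality test of two sets listed in the same order. -/
def listEq : List (Orb X) → List (Orb X) → Timed Bool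
  | [], [] => Timed.one true
  | [], _ :: _ => Timed.one false
  | _ :: _, [] => Timed.one false
  | o :: l, o' :: l' =>
    (orbEq o o').bind fun b => (listEq l l').bind fun c => Timed.one (b && c)

/-- The set `{x ∈ L | p x}`. -/
def filterSet (p : X → Timed Bool) (L : List (Orb X)) : Timed (List (Orb X)) :=
  Timed.filter (fun o => (sample o).bind p) L

/-- Insert an orbit into a set, unless it is already there. -/
def insertOrb (o : Orb X) : List (Orb X) → Timed (List (Orb X))
  | [] => Timed.one [o]
  | o' :: l => (orbEq o o').bind fun b =>
      if b then Timed.one (o' :: l) else (insertOrb o l).bind fun r => Timed.one (o' :: r)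

/-- The image `{f x | x ∈ L}`. -/
def mapSet (f : X → Timed Y) : List (Orb X) → Timed (List (Orb Y))
  | [] => Timed.one []
  | o :: l => (sample o).bind fun x => (f x).bind fun y => (toOrbit y).bind fun o' =>
      (mapSet f l).bind fun r => insertOrb o' r

/-- The letters of product strings: a position of the support of a pair `(x, y)` belongs to the
support of `x` only (`L`), of `y` only (`R`), or of both (`B`). -/
inductive Letter
  | L
  | R
  | B

/-- The letter is `L` or `B`. -/
def Letter.inLeft : Letter → Bool
  | L => true
  | R => false
  | B => true

/-- The letter is `R` or `B`. -/
def Letter.inRight : Letter → Bool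
  | L => false
  | R => true
  | B => true

/-- All strings with `i` letters among `L`, `B` and `j` letters among `R`, `B`, in a recursive
enumeration; prepending a letter to a string is one step. -/
def productStrings : ℕ → ℕ → Timed (List (List Letter))
  | 0, 0 => Timed.one [[]]
  | i + 1, 0 => (productStrings i 0).bind fun l => ⟨l.map (Letter.L :: ·), 1 + l.length⟩
  | 0, j + 1 => (productStrings 0 j).bind fun r => ⟨r.map (Letter.R :: ·), 1 + r.length⟩
  | i + 1, j + 1 =>
    (productStrings i (j + 1)).bind fun l =>
    (productStrings (i + 1) j).bind fun r =>
    (productStrings i j).bind fun b =>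
      ⟨l.map (Letter.L :: ·) ++ (r.map (Letter.R :: ·) ++ b.map (Letter.B :: ·)),
        1 + l.length + r.length + b.length⟩
termination_by i j => i + j

/-- The positions, numbered `q, q + 1, q + 2, …`, of the letters of a string that satisfy `p`. -/
def positions (p : Letter → Bool) : List Letter → ℚ → Finset ℚ
  | [], _ => ∅
  | c :: P, q => if p c then insert q (positions p P (q + 1)) else positions p P (q + 1)

/-- The orbit of `X × Y` described by a string and two orbits: that of the pair `(x, y)` where
`x ∈ o₁` and `y ∈ o₂` have the least supports prescribed by the string. -/
def productOrb (o₁ : Orb X) (o₂ : Orb Y) (P : List Letter) : Timed (Orb (X × Y)) :=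
  (getElement o₁ (positions Letter.inLeft P 0)).bind fun x =>
  (getElement o₂ (positions Letter.inRight P 0)).bind fun y =>
    toOrbit (x, y)

/-- The product of two sets: for every pair of orbits, enumerate the valid strings and construct
an orbit from each. -/
def productSet (L : List (Orb X)) (L' : List (Orb Y)) : Timed (List (Orb (X × Y))) :=
  Timed.flatMap (fun o₁ => Timed.flatMap (fun o₂ =>
    (orbDim o₁).bind fun i => (orbDim o₂).bind fun j =>
      (productStrings i j).bind fun ps => Timed.map (productOrb o₁ o₂) ps) L') L

end SetOperations

/-! ## Moore's algorithm -/

section Moore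

variable {S : Type u} {A : Type v} [MulAction Mon S] [MulAction Mon A]

/-- The relation `≡₀ = {(q₁, q₂) ∈ S × S | q₁ ∈ F ↔ q₂ ∈ F}`, computed from `S × S`. -/
def initialRel (M : NominalDFA S A) (SS : List (Orb (S × S))) : Timed (List (Orb (S × S))) :=
  filterSet (fun q =>
    (callPred (· ∈ M.final) q.1).bind fun b₁ =>
    (callPred (· ∈ M.final) q.2).bind fun b₂ => Timed.one (b₁ == b₂)) SS

/-- The test `(δ(q₁, a), δ(q₂, a)) ∈ R` for a triple `((q₁, q₂), a)`: two invocations of `δ`, the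
construction of an orbit, and one invocation of the predicate `· ∈ R`. -/
def checkTriple (M : NominalDFA S A) (R : List (Orb (S × S))) (x : (S × S) × A) : Timed Bool :=
  (call (fun y : S × A => M.step y.1 y.2) (x.1.1, x.2)).bind fun r₁ =>
  (call (fun y : S × A => M.step y.1 y.2) (x.1.2, x.2)).bind fun r₂ =>
  (toOrbit (r₁, r₂)).bind fun o => callPred (· ∈ R) o

/-- One refinement `{(q₁, q₂) ∈ R | ∀ a ∈ A, (δ(q₁, a), δ(q₂, a)) ∈ R}`: for every orbit `o` of `R`
the product `o × A` is computed and all its orbits are checked. -/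
def refine (M : NominalDFA S A) (LA : List (Orb A)) (R : List (Orb (S × S))) :
    Timed (List (Orb (S × S))) :=
  Timed.filter (fun o =>
    (productSet [o] LA).bind fun T =>
      Timed.all (fun t => (sample t).bind (checkTriple M R)) T) R

/-- The class `{t | (s, t) ∈ R}` of a state, assembled by a scan of the orbits of `R`. -/
def classOf : List (Orb (S × S)) → S → Timed (Set S)
  | [], _ => Timed.one ∅
  | o :: R, s => (classOf R s).bind fun c => Timed.one ({t | orb (s, t) = o} ∪ c)

open Classical in
/-- Choose an element of a set of states, if there is one. -/
def pick (e : Set S) : Timed (Option S) :=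
  Timed.one (if h : e.Nonempty then some h.some else none)

/-- The set of states `E = S/R`, a set of classes on which `Mon` acts by direct image. -/
def quotientStates (LS : List (Orb S)) (R : List (Orb (S × S))) : Timed (List (Orb (Set S))) :=
  mapSet (classOf R) LS

/-- The final states `F_E = {e ∈ E | ∀ s ∈ e, s ∈ F}`. -/
def quotientFinal (M : NominalDFA S A) (E : List (Orb (Set S))) : Timed (List (Orb (Set S))) :=
  filterSet (callPred fun e : Set S => ∀ s ∈ e, s ∈ M.final) E

/-- The transition function `δ_E`, as the set of orbits of its graph, one for each orbit of
`E × A`: for `s ∈ e` the value `δ_E(e, a)` is the class of `δ(s, a)`. -/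
def quotientStep (M : NominalDFA S A) (LA : List (Orb A)) (R : List (Orb (S × S)))
    (E : List (Orb (Set S))) : Timed (List (Orb ((Set S × A) × Set S))) :=
  (productSet E LA).bind fun EA => Timed.flatMap (fun o =>
    (sample o).bind fun x => (pick x.1).bind fun s? =>
      match s? with
      | none => Timed.one []
      | some s =>
        (call (fun y : S × A => M.step y.1 y.2) (s, x.2)).bind fun q =>
        (classOf R q).bind fun e' => (toOrbit (x, e')).bind fun r => Timed.one [r]) EA

/-- The output of the algorithm: the last relation `≡ᵢ` and the automaton `(E, A, F_E, δ_E)`. -/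
structure Output (S : Type u) (A : Type v) [MulAction Mon S] [MulAction Mon A] where
  rel : List (Orb (S × S))
  states : List (Orb (Set S))
  final : List (Orb (Set S))
  step : List (Orb ((Set S × A) × Set S))

/-- The part before the loop: the pair `(≡₋₁, ≡₀)`. -/
def mooreInit (M : NominalDFA S A) (LS : List (Orb S)) :
    Timed (List (Orb (S × S)) × List (Orb (S × S))) :=
  (productSet LS LS).bind fun SS => (initialRel M SS).bind fun R => Timed.one (SS, R)

/-- The loop test `≡ᵢ ≠ ≡ᵢ₋₁` on the pair `(≡ᵢ₋₁, ≡ᵢ)`. -/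
def mooreTest (st : List (Orb (S × S)) × List (Orb (S × S))) : Timed Bool :=
  (listEq st.2 st.1).bind fun b => Timed.one (!b)

/-- The loop body: from `(≡ᵢ₋₁, ≡ᵢ)` to `(≡ᵢ, ≡ᵢ₊₁)`. -/
def mooreBody (M : NominalDFA S A) (LA : List (Orb A))
    (st : List (Orb (S × S)) × List (Orb (S × S))) :
    Timed (List (Orb (S × S)) × List (Orb (S × S))) :=
  (refine M LA st.2).bind fun R => Timed.one (st.2, R)

/-- The part after the loop. -/
def mooreFinish (M : NominalDFA S A) (LS : List (Orb S)) (LA : List (Orb A))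
    (R : List (Orb (S × S))) : Timed (Output S A) :=
  (quotientStates LS R).bind fun E => (quotientFinal M E).bind fun FE =>
    (quotientStep M LA R E).bind fun D => Timed.one ⟨R, E, FE, D⟩

/-- Moore's algorithm, started on the automaton `M` with states and alphabet listed by `LS` and
`LA`, halts with output `out` after exactly `t` steps. -/
def MooreRuns (M : NominalDFA S A) (LS : List (Orb S)) (LA : List (Orb A))
    (out : Output S A) (t : ℕ) : Prop :=
  ∃ (st : List (Orb (S × S)) × List (Orb (S × S))) (tl : ℕ),
    WhileRuns mooreTest (mooreBody M LA) (mooreInit M LS).val st tl ∧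
    out = (mooreFinish M LS LA st.2).val ∧
    t = (mooreInit M LS).time + tl + (mooreFinish M LS LA st.2).time

/-- The output represents the quotient of `M` by language equivalence, which is the minimal
automaton: the relation is language equivalence, the states are its classes, a class is final if
its members are, and the transition function sends `([s], a)` to `[δ(s, a)]`. -/
structure IsMinimisation (M : NominalDFA S A) (out : Output S A) : Prop where
  rel_nodup : out.rel.Nodup
  rel_iff : ∀ s t : S, orb (s, t) ∈ out.rel ↔ M.lang s = M.lang t
  states_nodup : out.states.Nodup
  states_iff : ∀ e : Set S, orb e ∈ out.states ↔ ∃ s, e = M.langClass s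
  final_nodup : out.final.Nodup
  final_iff : ∀ e : Set S, orb e ∈ out.final ↔ ∃ s ∈ M.final, e = M.langClass s
  step_nodup : out.step.Nodup
  step_iff : ∀ (e : Set S) (a : A) (e' : Set S),
    orb ((e, a), e') ∈ out.step ↔ ∃ s, e = M.langClass s ∧ e' = M.langClass (M.step s a)

end Moore

end

end NominalMoore

open NominalMoore

/-!
The quotient of a nominal set by an equivariant partition is again nominal, and passing to a
strictly finer partition makes it strictly bigger in a measure with values in `ℕ`: the number of
orbits plus the sum of their dimensions (`potential`, `potential_lt`). A refinement can only split
orbits and enlarge least supports, and if it does neither, it is trivial, because over the total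
order symmetry an element is determined by its orbit together with its least support
(`eq_of_orb_eq`): a monotone bijection that maps a finite set onto itself fixes it pointwise. Since
the measure of a quotient of `S` is at most `numOrb S * (1 + dim S)`, chains of equivariant
partitions have length linear in `dim S` and in `numOrb S` (`encard_chain_le`), and so has the number
of passes of Moore's loop. The background on least supports comes from two facts: finite partial
monotone maps of `ℚ` extend to bijections (`exists_mon_eqOn`), and supports are closed under
intersection (`IsSupport.inter`).

The relations computed by the loop are `NominalDFA.approxEquiv n`, agreement on all words of length
less than `n`. They are represented by filtering one fixed list of the orbits of `S × S`
(`relList`), so that equality of lists is equality of relations, and when two consecutive ones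
coincide, they coincide with language equivalence (`NominalDFA.langEquiv_eq_of_stable`).

The enumeration of a product is correct because, up to a monotone bijection, the joint least support
of a pair is an initial segment of the natural numbers, and a product string records which of its
points come from which component (`mem_productSet`, `nodup_productSet`). At most `3 ^ (i + j)`
strings belong to orbits of dimensions `i` and `j`, and they are listed in `O(3 ^ (i + j))` steps.
Hence there are at most `numOrb S ^ 2 * 3 ^ (2 * k)` orbits of pairs of states; as these have
dimension at most `2 * k`, the product of each with the alphabet costs `O(numOrb A * 3 ^ (3 * k))`.
One pass of the loop therefore takes `O(3 ^ (5 * k) * numOrb S ^ 2 * numOrb A)` steps, and the bound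
on the number of passes contributes the remaining factor `k * numOrb S`.
-/

universe u v w

namespace NominalMoore

/-! ### Monotone bijections of `ℚ` -/

/-- The monotone bijection of `ℚ` that is the identity up to `m` and stretches by the factor `r`
above `m`. -/
def scaleAbove (m r : ℚ) (hr : 0 < r) : Mon :=
  StrictMono.orderIsoOfRightInverse (fun x => if x ≤ m then x else m + (x - m) * r)
    (by
      intro x y hxy
      dsimp only
      split_ifs with h1 h2 h2
      · exact hxy
      · have : 0 < (y - m) * r := mul_pos (by linarith [not_le.1 h2]) hr
        linarith
      · linarith
      · have : (x - m) * r < (y - m) * r := mul_lt_mul_of_pos_right (by linarith) hr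
        linarith)
    (fun x => if x ≤ m then x else m + (x - m) * r⁻¹)
    (by
      intro x
      dsimp only
      by_cases h : x ≤ m
      · simp [h]
      · have : 0 < (x - m) * r⁻¹ := mul_pos (by linarith [not_le.1 h]) (inv_pos.2 hr)
        rw [if_neg h, if_neg (by linarith)]
        field_simp
        ring)

theorem scaleAbove_apply (m r : ℚ) (hr : 0 < r) (x : ℚ) :
    scaleAbove m r hr x = if x ≤ m then x else m + (x - m) * r := rfl

/-- Homogeneity of `(ℚ, <)`: every strictly monotone map on a finite set extends to a monotone
bijection. -/
theorem exists_mon_eqOn (E : Finset ℚ) (f : ℚ → ℚ) (hf : StrictMonoOn f E) :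
    ∃ g : Mon, ∀ x ∈ E, g x = f x := by
  induction E using Finset.induction_on_max with
  | empty => exact ⟨1, by simp⟩
  | insert a E ha ih =>
    obtain ⟨g, hg⟩ := ih (hf.mono (by simp))
    -- a point that separates the image of `E` from the old and the new image of `a`
    obtain ⟨m, hm, hma, hmf⟩ : ∃ m, (∀ x ∈ E, g x ≤ m) ∧ m < g a ∧ m < f a := by
      rcases E.eq_empty_or_nonempty with rfl | hE
      · exact ⟨min (g a) (f a) - 1, by simp, by linarith [min_le_left (g a) (f a)],
          by linarith [min_le_right (g a) (f a)]⟩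
      · refine ⟨g (E.max' hE), fun x hx => g.monotone (E.le_max' x hx),
          g.strictMono (ha _ (E.max'_mem hE)), ?_⟩
        rw [hg _ (E.max'_mem hE)]
        exact hf (by simp [E.max'_mem hE]) (by simp) (ha _ (E.max'_mem hE))
    have h1 : 0 < g a - m := by linarith
    have h2 : 0 < f a - m := by linarith
    refine ⟨scaleAbove m ((f a - m) / (g a - m)) (div_pos h2 h1) * g, fun x hx => ?_⟩
    rw [RelIso.mul_apply, scaleAbove_apply]
    rcases Finset.mem_insert.1 hx with rfl | hx
    · rw [if_neg (by linarith)]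
      field_simp
      ring
    · rw [if_pos (hm x hx), hg x hx]

/-- A monotone bijection that maps a finite set onto itself fixes it pointwise. This rigidity is
what makes the total order symmetry simpler than the other symmetries: an element is determined by
its orbit and its least support. -/
theorem apply_eq_of_image_eq {C : Set ℚ} (hC : C.Finite) (g : Mon) (h : g '' C = C) :
    ∀ q ∈ C, g q = q := by
  by_contra! hne
  obtain ⟨q, ⟨hq, hgq⟩, hmin⟩ :=
    Set.exists_min_image {q ∈ C | g q ≠ q} id (hC.subset (Set.sep_subset _ _)) hne
  have hfix : ∀ p ∈ C, p < q → g p = p := fun p hp hpq => by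
    by_contra hgp
    exact absurd (hmin p ⟨hp, hgp⟩) (not_le.2 hpq)
  rcases lt_or_gt_of_ne hgq with hlt | hlt
  · exact hgq (g.injective (hfix _ (h ▸ Set.mem_image_of_mem g hq) hlt))
  · obtain ⟨p, hp, hpq⟩ : q ∈ g '' C := h.symm ▸ hq
    have hlt' : p < q := g.lt_iff_lt.1 (by rwa [hpq])
    exact hlt'.ne ((hfix p hp hlt').symm.trans hpq)

/-! ### Least supports -/

section Support

variable {X : Type u} {Y : Type v} [MulAction Mon X] [MulAction Mon Y]

theorem orb_eq_iff {x y : X} : orb x = orb y ↔ ∃ g : Mon, g • y = x := by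
  unfold orb
  rw [Quotient.eq (r := MulAction.orbitRel Mon X), MulAction.orbitRel_apply, MulAction.mem_orbit_iff]

@[simp]
theorem orb_smul (g : Mon) (x : X) : orb (g • x) = orb x := orb_eq_iff.2 ⟨g, rfl⟩

@[simp]
theorem orb_out (o : Orb X) : orb (Quotient.out o) = o := Quotient.out_eq o

theorem IsSupport.smul {C : Finset ℚ} {x : X} (h : IsSupport C x) (g : Mon) :
    IsSupport (C.image g) (g • x) := by
  intro u hu
  have : (g⁻¹ * u * g) • x = x := h _ fun q hq => by
    simp only [RelIso.mul_apply]
    rw [hu (g q) (Finset.mem_image_of_mem g hq)]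
    exact RelIso.inv_apply_self g q
  rw [mul_smul, mul_smul, inv_smul_eq_iff] at this
  exact this

/-- A point of a support that is missing from another support can be removed. -/
theorem IsSupport.erase {C D : Finset ℚ} {x : X} (hC : IsSupport C x) (hD : IsSupport D x)
    {c : ℚ} (hcD : c ∉ D) : IsSupport (C.erase c) x := by
  have key : ∀ g : Mon, (∀ q ∈ C.erase c, g q = q) → c ≤ g c → g • x = x := by
    intro g hg hc
    -- `u` fixes `C` and pushes the points of `D` above `c` beyond `g c`
    obtain ⟨u, hu⟩ := exists_mon_eqOn (C ∪ D) (fun q => if q ≤ c then q else g q) (by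
      intro p _ q _ hpq
      dsimp only
      split_ifs with h1 h2 h2
      · exact hpq
      · exact h1.trans_lt (hc.trans_lt (g.strictMono (not_le.1 h2)))
      · exact absurd (hpq.le.trans h2) h1
      · exact g.strictMono hpq)
    have hux : u • x = x := hC u fun q hq => by
      rw [hu q (Finset.mem_union_left _ hq)]
      split_ifs with h
      · rfl
      · exact hg q (Finset.mem_erase.2 ⟨fun h' => h h'.le, hq⟩)
    have hsep : ∀ q ∈ C.erase c ∪ D.image u, q < c ∨ g c < q := by
      intro q hq
      rcases Finset.mem_union.1 hq with hq | hq
      · rcases lt_or_gt_of_ne (Finset.ne_of_mem_erase hq) with h | h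
        · exact Or.inl h
        · right
          rw [← hg q hq]
          exact g.strictMono h
      · obtain ⟨d, hd, rfl⟩ := Finset.mem_image.1 hq
        rw [hu d (Finset.mem_union_right _ hd)]
        split_ifs with h
        · exact Or.inl (lt_of_le_of_ne h fun h' => hcD (h' ▸ hd))
        · exact Or.inr (g.strictMono (not_le.1 h))
    -- nothing lies between `c` and `g c` any more, so `c` can be moved to `g c`
    obtain ⟨h, hh⟩ := exists_mon_eqOn (insert c (C.erase c ∪ D.image u))
      (fun q => if q = c then g c else q) (by
      intro p hp q hq hpq
      dsimp only
      split_ifs with h1 h2 h2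
      · exact absurd (h1.trans h2.symm) hpq.ne
      · rcases hsep q (Finset.mem_of_mem_insert_of_ne hq h2) with h | h
        · exact absurd (h1 ▸ hpq) h.not_gt
        · exact h
      · exact (h2 ▸ hpq).trans_le hc
      · exact hpq)
    have hhx : h • x = x := by
      have hD' : IsSupport (D.image u) x := by
        have := hD.smul u
        rwa [hux] at this
      refine hD' h fun q hq => ?_
      have hq' := Finset.mem_union_right (C.erase c) hq
      rw [hh q (Finset.mem_insert_of_mem hq'), if_neg]
      rintro rfl
      rcases hsep _ hq' with h' | h'
      · exact lt_irrefl _ h'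
      · exact hc.not_gt h'
    have hhg : (h⁻¹ * g) • x = x := hC _ fun q hq => by
      rw [RelIso.mul_apply]
      have : g q = h q := by
        by_cases hqc : q = c
        · rw [hh q (by simp [hqc]), if_pos hqc, hqc]
        · have hq' : q ∈ C.erase c := Finset.mem_erase.2 ⟨hqc, hq⟩
          rw [hg q hq', hh q (by simp [hq, hqc]), if_neg hqc]
      rw [this]
      exact RelIso.inv_apply_self h q
    rwa [mul_smul, inv_smul_eq_iff, hhx] at hhg
  intro g hg
  rcases le_total c (g c) with hc | hc
  · exact key g hg hc
  · have := key g⁻¹ (fun q hq => by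
      conv_lhs => rw [← hg q hq]
      exact RelIso.inv_apply_self g q) (by
      rw [← g.le_iff_le, RelIso.apply_inv_self]
      exact hc)
    rw [inv_smul_eq_iff] at this
    exact this.symm

theorem IsSupport.inter {C D : Finset ℚ} {x : X} (hC : IsSupport C x) (hD : IsSupport D x) :
    IsSupport (C ∩ D) x := by
  have key : ∀ E : Finset ℚ, Disjoint E D → IsSupport (C \ E) x := by
    intro E
    induction E using Finset.induction_on with
    | empty => intro _; simpa using hC
    | insert c E _ ih =>
      intro h
      rw [Finset.disjoint_insert_left] at h
      have := (ih h.2).erase hD h.1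
      rwa [← Finset.sdiff_insert] at this
  have := key (C \ D) Finset.sdiff_disjoint
  rwa [sdiff_sdiff_right_self] at this

/-- The total order symmetry admits least supports. -/
theorem exists_leastSupport_eq {x : X} (hx : ∃ C, IsSupport C x) :
    ∃ C : Finset ℚ, IsSupport C x ∧ leastSupport x = ↑C := by
  classical
  obtain ⟨C, hC, hmin⟩ := WellFounded.has_min
    (InvImage.wf Finset.card (Nat.lt_wfRel.wf)) {C : Finset ℚ | IsSupport C x} hx
  refine ⟨C, hC, Set.ext fun q => ⟨fun hq => hq C hC, fun hq D hD => ?_⟩⟩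
  have h1 : ¬ (C ∩ D).card < C.card := hmin _ (hC.inter hD)
  have h2 : C ∩ D = C := Finset.eq_of_subset_of_card_le Finset.inter_subset_left (not_lt.1 h1)
  exact (Finset.mem_inter.1 (h2.symm ▸ (Finset.mem_coe.1 hq))).2

theorem leastSupport_finite {x : X} (hx : ∃ C, IsSupport C x) : (leastSupport x).Finite := by
  obtain ⟨C, -, hC⟩ := exists_leastSupport_eq hx
  exact hC ▸ C.finite_toSet

theorem leastSupport_smul (g : Mon) (x : X) : leastSupport (g • x) = g '' leastSupport x := by
  have key : ∀ (g : Mon) (x : X), g '' leastSupport x ⊆ leastSupport (g • x) := by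
    rintro g x _ ⟨q, hq, rfl⟩ C hC
    have h := hC.smul g⁻¹
    rw [inv_smul_smul] at h
    obtain ⟨p, hp, hpq⟩ := Finset.mem_image.1 (hq _ h)
    rw [← hpq, RelIso.apply_inv_self]
    exact hp
  refine Set.Subset.antisymm (fun q hq => ⟨g⁻¹ q, ?_, RelIso.apply_inv_self g q⟩) (key g x)
  have := key g⁻¹ (g • x) ⟨q, hq, rfl⟩
  rwa [inv_smul_smul] at this

theorem dimElt_smul (g : Mon) (x : X) : dimElt (g • x) = dimElt x := by
  rw [dimElt, leastSupport_smul, Set.ncard_image_of_injective _ g.injective, dimElt]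

theorem dimElt_congr {x y : X} (h : orb x = orb y) : dimElt x = dimElt y := by
  obtain ⟨g, rfl⟩ := orb_eq_iff.1 h
  exact dimElt_smul g y

theorem exists_isSupport_congr {x y : X} (h : orb x = orb y) (hx : ∃ C, IsSupport C x) :
    ∃ C, IsSupport C y := by
  obtain ⟨g, rfl⟩ := orb_eq_iff.1 h.symm
  exact hx.imp' (·.image g) fun C hC => hC.smul g

theorem smul_eq_of_leastSupport {x : X} (hx : ∃ C, IsSupport C x) (g : Mon)
    (hg : ∀ q ∈ leastSupport x, g q = q) : g • x = x := by
  obtain ⟨C, hC, hCx⟩ := exists_leastSupport_eq hx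
  exact hC g fun q hq => hg q (hCx ▸ hq)

/-- An element is determined by its orbit and its least support. -/
theorem eq_of_orb_eq {x y : X} (hx : ∃ C, IsSupport C x) (h : orb x = orb y)
    (hs : leastSupport x = leastSupport y) : x = y := by
  obtain ⟨g, rfl⟩ := orb_eq_iff.1 h.symm
  rw [leastSupport_smul] at hs
  exact (smul_eq_of_leastSupport hx g
    (apply_eq_of_image_eq (leastSupport_finite hx) g hs.symm)).symm

theorem leastSupport_subset {x : X} {y : Y} (hx : ∃ C, IsSupport C x)
    (h : ∀ g : Mon, g • x = x → g • y = y) : leastSupport y ⊆ leastSupport x := by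
  obtain ⟨C, hC, hCx⟩ := exists_leastSupport_eq hx
  intro q hq
  rw [hCx]
  exact hq C fun g hg => h g (hC g hg)

theorem dimElt_le_dimElt {x : X} {y : Y} (hx : ∃ C, IsSupport C x)
    (h : ∀ g : Mon, g • x = x → g • y = y) : dimElt y ≤ dimElt x :=
  Set.ncard_le_ncard (leastSupport_subset hx h) (leastSupport_finite hx)

theorem exists_isSupport_prod {x : X} {y : Y} (hx : ∃ C, IsSupport C x) (hy : ∃ C, IsSupport C y) :
    ∃ C, IsSupport C (x, y) := by
  classical
  obtain ⟨C, hC⟩ := hx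
  obtain ⟨D, hD⟩ := hy
  refine ⟨C ∪ D, fun g hg => Prod.ext ?_ ?_⟩
  · exact hC g fun q hq => hg q (Finset.mem_union_left _ hq)
  · exact hD g fun q hq => hg q (Finset.mem_union_right _ hq)

theorem dimElt_prod_le {x : X} {y : Y} (hx : ∃ C, IsSupport C x) (hy : ∃ C, IsSupport C y) :
    dimElt (x, y) ≤ dimElt x + dimElt y := by
  classical
  obtain ⟨C, hC, hCx⟩ := exists_leastSupport_eq hx
  obtain ⟨D, hD, hDy⟩ := exists_leastSupport_eq hy
  have h : leastSupport (x, y) ⊆ ↑(C ∪ D) := fun q hq => hq _ fun g hg => Prod.ext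
    (hC g fun q hq => hg q (Finset.mem_union_left _ hq))
    (hD g fun q hq => hg q (Finset.mem_union_right _ hq))
  rw [dimElt, dimElt, dimElt, hCx, hDy, Set.ncard_coe_finset, Set.ncard_coe_finset]
  refine (Set.ncard_le_ncard h (Finset.finite_toSet _)).trans ?_
  rw [Set.ncard_coe_finset]
  exact Finset.card_union_le C D

theorem dimElt_le_dim (hX : OrbitFiniteNominal X) (x : X) : dimElt x ≤ dim X := by
  have := hX.orbitFinite
  refine le_ciSup (f := fun x : X => dimElt x) ?_ x
  refine ((Set.finite_range fun o : Orb X => dimElt o.out).subset ?_).bddAbove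
  rintro _ ⟨x, rfl⟩
  exact ⟨orb x, dimElt_congr (orb_out _)⟩

theorem dim_le {n : ℕ} (h : ∀ x : X, dimElt x ≤ n) : dim X ≤ n := by
  rcases isEmpty_or_nonempty X with _ | _
  · simp [dim]
  · exact ciSup_le h

theorem isSupport_inl {C : Finset ℚ} {x : X} :
    IsSupport C (Sum.inl x : X ⊕ Y) ↔ IsSupport C x :=
  forall₂_congr fun g _ => by rw [Sum.smul_inl, Sum.inl.injEq]

theorem isSupport_inr {C : Finset ℚ} {y : Y} :
    IsSupport C (Sum.inr y : X ⊕ Y) ↔ IsSupport C y :=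
  forall₂_congr fun g _ => by rw [Sum.smul_inr, Sum.inr.injEq]

theorem dimElt_inl (x : X) : dimElt (Sum.inl x : X ⊕ Y) = dimElt x := by
  simp only [dimElt, leastSupport, isSupport_inl]

theorem dimElt_inr (y : Y) : dimElt (Sum.inr y : X ⊕ Y) = dimElt y := by
  simp only [dimElt, leastSupport, isSupport_inr]

theorem dimElt_le_dim_sum (hX : OrbitFiniteNominal X) (hY : OrbitFiniteNominal Y) (z : X ⊕ Y) :
    dimElt z ≤ dim (X ⊕ Y) := by
  refine le_ciSup (f := fun z : X ⊕ Y => dimElt z) ⟨max (dim X) (dim Y), ?_⟩ z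
  rintro _ ⟨z | z, rfl⟩
  · dsimp only
    rw [dimElt_inl]
    exact (dimElt_le_dim hX z).trans (le_max_left _ _)
  · dsimp only
    rw [dimElt_inr]
    exact (dimElt_le_dim hY z).trans (le_max_right _ _)

theorem dim_le_dim_sum_left (hX : OrbitFiniteNominal X) (hY : OrbitFiniteNominal Y) :
    dim X ≤ dim (X ⊕ Y) :=
  dim_le fun x => (dimElt_inl (Y := Y) x).symm.trans_le (dimElt_le_dim_sum hX hY _)

theorem dim_le_dim_sum_right (hX : OrbitFiniteNominal X) (hY : OrbitFiniteNominal Y) :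
    dim Y ≤ dim (X ⊕ Y) :=
  dim_le fun y => (dimElt_inr (X := X) y).symm.trans_le (dimElt_le_dim_sum hX hY _)

end Support

/-! ### Chains of equivariant partitions -/

section Partition

variable {S : Type u}

/-- The class of `x`, as an element of the `Mon`-set `Set S`. Encoding `S / r` by sets of states
keeps the quotients by all relations inside one type. -/
def eqvClass (r : Setoid S) (x : S) : Set S := {y | r x y}

theorem eqvClass_eq_iff {r : Setoid S} {x y : S} : eqvClass r x = eqvClass r y ↔ r x y := by
  constructor
  · intro h
    have : y ∈ eqvClass r y := r.refl y
    rwa [← h] at this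
  · intro h
    ext z
    exact ⟨fun hz => r.trans (r.symm h) hz, fun hz => r.trans h hz⟩

variable [MulAction Mon S]

theorem smul_eqvClass {r : Setoid S} (hr : IsEquivariantPartition r) (g : Mon) (x : S) :
    g • eqvClass r x = eqvClass r (g • x) := by
  ext z
  rw [Set.mem_smul_set_iff_inv_smul_mem]
  constructor
  · intro h
    have := hr g _ _ h
    rwa [smul_inv_smul] at this
  · intro h
    have := hr g⁻¹ _ _ h
    rwa [inv_smul_smul] at this

theorem exists_isSupport_eqvClass {r : Setoid S} (hr : IsEquivariantPartition r) {x : S}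
    (hx : ∃ C, IsSupport C x) : ∃ C, IsSupport C (eqvClass r x) :=
  hx.imp fun C hC g hg => by rw [smul_eqvClass hr, hC g hg]

theorem leastSupport_eqvClass_subset {r r' : Setoid S} (hr : IsEquivariantPartition r)
    (hr' : IsEquivariantPartition r') (h : r' ≤ r) {x : S} (hx : ∃ C, IsSupport C x) :
    leastSupport (eqvClass r x) ⊆ leastSupport (eqvClass r' x) :=
  leastSupport_subset (exists_isSupport_eqvClass hr' hx) fun g hg => by
    rw [smul_eqvClass hr', eqvClass_eq_iff] at hg
    rw [smul_eqvClass hr, eqvClass_eq_iff]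
    exact h hg

theorem dimElt_eqvClass_le {r : Setoid S} (hr : IsEquivariantPartition r) {x : S}
    (hx : ∃ C, IsSupport C x) : dimElt (eqvClass r x) ≤ dimElt x :=
  dimElt_le_dimElt hx fun g hg => by rw [smul_eqvClass hr, hg]

/-- The orbits of the quotient `S / r`. -/
def quotientOrbits (r : Setoid S) : Set (Orb (Set S)) :=
  Set.range fun x => orb (eqvClass r x)

theorem quotientOrbits_eq_range {r : Setoid S} (hr : IsEquivariantPartition r) :
    quotientOrbits r = Set.range fun o : Orb S => orb (eqvClass r o.out) := by
  refine Set.Subset.antisymm ?_ ?_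
  · rintro _ ⟨x, rfl⟩
    refine ⟨orb x, ?_⟩
    obtain ⟨g, hg⟩ := orb_eq_iff.1 (orb_out (orb x))
    dsimp only
    rw [← hg, ← smul_eqvClass hr, orb_smul]
  · rintro _ ⟨o, rfl⟩
    exact ⟨o.out, rfl⟩

theorem quotientOrbits_finite [Finite (Orb S)] {r : Setoid S} (hr : IsEquivariantPartition r) :
    (quotientOrbits r).Finite := by
  rw [quotientOrbits_eq_range hr]
  exact Set.finite_range _

/-- The potential of an equivariant partition: the number of orbits of the quotient plus the sum
of their dimensions. -/
noncomputable def potential (r : Setoid S) : ℕ :=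
  ∑ᶠ O ∈ quotientOrbits r, (1 + dimElt (Quotient.out O))

theorem potential_le (hS : OrbitFiniteNominal S) {r : Setoid S} (hr : IsEquivariantPartition r) :
    potential r ≤ numOrb S * (1 + dim S) := by
  have := hS.orbitFinite
  have hfin := quotientOrbits_finite hr
  rw [potential, finsum_mem_eq_finite_toFinset_sum _ hfin]
  refine (Finset.sum_le_card_nsmul _ _ (1 + dim S) ?_).trans ?_
  · intro O hO
    obtain ⟨x, rfl⟩ := hfin.mem_toFinset.1 hO
    refine Nat.add_le_add_left ?_ 1
    rw [dimElt_congr (orb_out _)]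
    exact (dimElt_eqvClass_le hr (hS.nominal x)).trans (dimElt_le_dim hS x)
  · rw [smul_eq_mul]
    refine Nat.mul_le_mul_right _ ?_
    rw [← Set.ncard_eq_toFinset_card _ hfin, quotientOrbits_eq_range hr, ← Nat.card_coe_set_eq]
    exact Finite.card_range_le _

/-- A proper refinement splits an orbit of the quotient or raises the dimension of one: an
equivariant surjection between single orbits of equal dimension is injective, by
`eq_of_orb_eq`. -/
theorem potential_lt (hS : OrbitFiniteNominal S) {r r' : Setoid S}
    (hr : IsEquivariantPartition r) (hr' : IsEquivariantPartition r') (h : r' < r) :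
    potential r < potential r' := by
  classical
  have := hS.orbitFinite
  have hfin := quotientOrbits_finite hr
  have hfin' := quotientOrbits_finite hr'
  -- the surjection from `S / r'` to `S / r` on orbits
  have hproj : ∀ x y, orb (eqvClass r' x) = orb (eqvClass r' y) →
      orb (eqvClass r x) = orb (eqvClass r y) := by
    intro x y hxy
    obtain ⟨g, hg⟩ := orb_eq_iff.1 hxy
    rw [smul_eqvClass hr', eqvClass_eq_iff] at hg
    refine orb_eq_iff.2 ⟨g, ?_⟩
    rw [smul_eqvClass hr, eqvClass_eq_iff]
    exact h.le hg
  have hdim : ∀ x, dimElt (eqvClass r x) ≤ dimElt (eqvClass r' x) := fun x =>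
    Set.ncard_le_ncard (leastSupport_eqvClass_subset hr hr' h.le (hS.nominal x))
      (leastSupport_finite (exists_isSupport_eqvClass hr' (hS.nominal x)))
  -- a section of that surjection
  have hsec : ∀ O : quotientOrbits r, ∃ x, orb (eqvClass r x) = O := fun O => O.2
  choose x hx using hsec
  let σ : quotientOrbits r → Orb (Set S) := fun O => orb (eqvClass r' (x O))
  have hσ : Function.Injective σ := fun O O' hO =>
    Subtype.ext ((hx O).symm.trans ((hproj _ _ hO).trans (hx O')))
  have : Fintype (quotientOrbits r) := hfin.fintype
  have hsub : Finset.univ.image σ ⊆ hfin'.toFinset := by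
    intro O hO
    obtain ⟨O', -, rfl⟩ := Finset.mem_image.1 hO
    exact hfin'.mem_toFinset.2 ⟨_, rfl⟩
  have hle : ∀ O : quotientOrbits r,
      1 + dimElt (Quotient.out (O : Orb (Set S))) ≤ 1 + dimElt (Quotient.out (σ O)) := by
    intro O
    rw [dimElt_congr ((orb_out _).trans (hx O).symm), dimElt_congr (orb_out (σ O))]
    exact Nat.add_le_add_left (hdim _) 1
  have h1 : potential r = ∑ O : quotientOrbits r, (1 + dimElt (Quotient.out (O : Orb (Set S)))) := by
    rw [potential, finsum_mem_eq_finite_toFinset_sum _ hfin]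
    exact (Finset.sum_subtype _ (fun _ => hfin.mem_toFinset) _)
  have h2 : ∑ O : quotientOrbits r, (1 + dimElt (Quotient.out (σ O))) =
      ∑ O ∈ Finset.univ.image σ, (1 + dimElt (Quotient.out O)) :=
    (Finset.sum_image (f := fun O : Orb (Set S) => 1 + dimElt (Quotient.out O))
      (fun O _ O' _ hO => hσ hO)).symm
  have h3 : potential r' = ∑ O ∈ hfin'.toFinset, (1 + dimElt (Quotient.out O)) := by
    rw [potential, finsum_mem_eq_finite_toFinset_sum _ hfin']
  refine lt_of_le_of_ne ?_ fun heq => h.not_ge ?_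
  · rw [h1, h3]
    exact (Finset.sum_le_sum fun O _ => hle O).trans (h2.le.trans
      (Finset.sum_le_sum_of_subset hsub))
  -- equality forces `σ` to be onto and all dimensions to agree
  have hsum : ∑ O : quotientOrbits r, (1 + dimElt (Quotient.out (O : Orb (Set S)))) =
      ∑ O : quotientOrbits r, (1 + dimElt (Quotient.out (σ O))) :=
    le_antisymm (Finset.sum_le_sum fun O _ => hle O) (by
      rw [← h1, heq, h3, h2]
      exact Finset.sum_le_sum_of_subset hsub)
  have hdimeq := (Finset.sum_eq_sum_iff_of_le fun O _ => hle O).1 hsum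
  have himg : Finset.univ.image σ = hfin'.toFinset := by
    by_contra hne
    have hlt : ∑ O ∈ Finset.univ.image σ, (1 + dimElt (Quotient.out O)) <
        ∑ O ∈ hfin'.toFinset, (1 + dimElt (Quotient.out O)) := by
      obtain ⟨O, hO, hO'⟩ := Finset.exists_of_ssubset (hsub.ssubset_of_ne hne)
      exact Finset.sum_lt_sum_of_subset hsub hO hO' (by positivity) (fun _ _ _ => Nat.zero_le _)
    rw [← h2, ← hsum, ← h1, ← h3] at hlt
    exact hlt.ne heq
  have hfib : ∀ y, ∃ O : quotientOrbits r, (O : Orb (Set S)) = orb (eqvClass r y) ∧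
      σ O = orb (eqvClass r' y) := by
    intro y
    have hy : orb (eqvClass r' y) ∈ Finset.univ.image σ := by
      rw [himg]
      exact hfin'.mem_toFinset.2 ⟨y, rfl⟩
    obtain ⟨O, -, hO⟩ := Finset.mem_image.1 hy
    exact ⟨O, (hx O).symm.trans (hproj _ _ hO), hO⟩
  have hsupp : ∀ y, leastSupport (eqvClass r y) = leastSupport (eqvClass r' y) := by
    intro y
    obtain ⟨O, hO, hO'⟩ := hfib y
    have h4 := Nat.add_left_cancel (hdimeq O (Finset.mem_univ O))
    rw [hO', hO, dimElt_congr (orb_out _), dimElt_congr (orb_out _)] at h4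
    exact Set.eq_of_subset_of_ncard_le (leastSupport_eqvClass_subset hr hr' h.le (hS.nominal y))
      h4.ge (leastSupport_finite (exists_isSupport_eqvClass hr' (hS.nominal y)))
  intro y z hyz
  obtain ⟨O₁, h4, h5⟩ := hfib y
  obtain ⟨O₂, h6, h7⟩ := hfib z
  have hyz' := eqvClass_eq_iff.2 hyz
  have hO : O₁ = O₂ := Subtype.ext (by rw [h4, h6, hyz'])
  exact eqvClass_eq_iff.1 (eq_of_orb_eq (exists_isSupport_eqvClass hr' (hS.nominal y))
    (by rw [← h5, ← h7, hO]) (by rw [← hsupp, ← hsupp, hyz']))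

theorem potential_le_max (hS : OrbitFiniteNominal S) {r : Setoid S}
    (hr : IsEquivariantPartition r) :
    potential r ≤ 2 * (max 1 (dim S) * max 1 (numOrb S)) :=
  calc potential r ≤ numOrb S * (1 + dim S) := potential_le hS hr
    _ ≤ max 1 (numOrb S) * (2 * max 1 (dim S)) := by
      refine Nat.mul_le_mul (le_max_right _ _) ?_
      have h1 := le_max_left 1 (dim S)
      have h2 := le_max_right 1 (dim S)
      omega
    _ = 2 * (max 1 (dim S) * max 1 (numOrb S)) := by ring

theorem encard_chain_le (hS : OrbitFiniteNominal S) (c : Set (Setoid S))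
    (hc : ∀ r ∈ c, IsEquivariantPartition r) (hchain : IsChain (· ≤ ·) c) :
    c.encard ≤ ((3 * (max 1 (dim S) * max 1 (numOrb S)) : ℕ) : ℕ∞) := by
  have hinj : Set.InjOn potential c := by
    intro r hr r' hr' heq
    by_contra hne
    rcases hchain hr hr' hne with h | h
    · exact (potential_lt hS (hc r' hr') (hc r hr) (h.lt_of_ne hne)).ne heq.symm
    · exact (potential_lt hS (hc r hr) (hc r' hr') (h.lt_of_ne (Ne.symm hne))).ne heq
  rw [← hinj.encard_image]
  set B := max 1 (dim S) * max 1 (numOrb S) with hB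
  have hB1 : 1 ≤ B := Nat.one_le_iff_ne_zero.2 (by positivity)
  have hsub : potential '' c ⊆ ↑(Finset.range (2 * B + 1)) := by
    rintro _ ⟨r, hr, rfl⟩
    have := potential_le_max hS (hc r hr)
    simp only [Finset.coe_range, Set.mem_Iio]
    omega
  refine (Set.encard_le_encard hsub).trans ?_
  rw [Set.encard_coe_eq_coe_finsetCard, Finset.card_range]
  exact_mod_cast (by omega : 2 * B + 1 ≤ 3 * B)

end Partition

/-! ### Values and times of the list operations -/

namespace Timed

variable {α : Type u} {β : Type v}

@[simp]
theorem one_val (a : α) : (one a).val = a := rfl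

@[simp]
theorem one_time (a : α) : (one a).time = 1 := rfl

@[simp]
theorem bind_val (x : Timed α) (f : α → Timed β) : (x.bind f).val = (f x.val).val := rfl

@[simp]
theorem bind_time (x : Timed α) (f : α → Timed β) :
    (x.bind f).time = x.time + (f x.val).time := rfl

theorem map_val (f : α → Timed β) (l : List α) : (map f l).val = l.map fun a => (f a).val := by
  induction l with
  | nil => rfl
  | cons a l ih => simp [map, ih]

theorem flatMap_val (f : α → Timed (List β)) (l : List α) :
    (flatMap f l).val = l.flatMap fun a => (f a).val := by
  induction l with
  | nil => rfl
  | cons a l ih => simp [flatMap, ih]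

theorem filter_val (p : α → Timed Bool) (l : List α) :
    (filter p l).val = l.filter fun a => (p a).val := by
  induction l with
  | nil => rfl
  | cons a l ih => simp [filter, ih, List.filter_cons]

theorem all_val (p : α → Timed Bool) (l : List α) :
    (all p l).val = l.all fun a => (p a).val := by
  induction l with
  | nil => rfl
  | cons a l ih => simp [all, ih]

theorem map_time_le {f : α → Timed β} {l : List α} {c : ℕ} (h : ∀ a ∈ l, (f a).time ≤ c) :
    (map f l).time ≤ 1 + l.length * (c + 1) := by
  induction l with
  | nil => simp [map]
  | cons a l ih =>
    have h1 := h a List.mem_cons_self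
    have h2 := ih fun b hb => h b (List.mem_cons_of_mem a hb)
    simp only [map, bind_time, one_time, List.length_cons, Nat.add_one_mul]
    omega

theorem flatMap_time_le {f : α → Timed (List β)} {l : List α} {c d : ℕ}
    (h : ∀ a ∈ l, (f a).time ≤ c) (hd : ∀ a ∈ l, (f a).val.length ≤ d) :
    (flatMap f l).time ≤ 1 + l.length * (c + 1 + d) := by
  induction l with
  | nil => simp [flatMap]
  | cons a l ih =>
    have h1 := h a List.mem_cons_self
    have h2 := ih (fun b hb => h b (List.mem_cons_of_mem a hb))
      (fun b hb => hd b (List.mem_cons_of_mem a hb))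
    have h3 := hd a List.mem_cons_self
    simp only [flatMap, bind_time, List.length_cons, Nat.add_one_mul]
    omega

theorem flatMap_length_le {f : α → Timed (List β)} {l : List α} {d : ℕ}
    (hd : ∀ a ∈ l, (f a).val.length ≤ d) : (flatMap f l).val.length ≤ l.length * d := by
  induction l with
  | nil => simp [flatMap]
  | cons a l ih =>
    have h2 := ih fun b hb => hd b (List.mem_cons_of_mem a hb)
    have h3 := hd a List.mem_cons_self
    simp only [flatMap, bind_val, List.length_cons, List.length_append, Nat.add_one_mul]
    omega

theorem filter_time_le {p : α → Timed Bool} {l : List α} {c : ℕ} (h : ∀ a ∈ l, (p a).time ≤ c) :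
    (filter p l).time ≤ 1 + l.length * (c + 1) := by
  induction l with
  | nil => simp [filter]
  | cons a l ih =>
    have h1 := h a List.mem_cons_self
    have h2 := ih fun b hb => h b (List.mem_cons_of_mem a hb)
    simp only [filter, bind_time, one_time, List.length_cons, Nat.add_one_mul]
    omega

theorem all_time_le {p : α → Timed Bool} {l : List α} {c : ℕ} (h : ∀ a ∈ l, (p a).time ≤ c) :
    (all p l).time ≤ 1 + l.length * (c + 1) := by
  induction l with
  | nil => simp [all]
  | cons a l ih =>
    have h1 := h a List.mem_cons_self
    have h2 := ih fun b hb => h b (List.mem_cons_of_mem a hb)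
    simp only [all, bind_time, one_time, List.length_cons, Nat.add_one_mul]
    omega

end Timed

section SetOperationCosts

variable {X : Type u} {Y : Type v} [MulAction Mon X] [MulAction Mon Y]

theorem listEq_val (l l' : List (Orb X)) : (listEq l l').val = true ↔ l = l' := by
  induction l generalizing l' with
  | nil => cases l' <;> simp [listEq]
  | cons o l ih =>
    cases l' with
    | nil => simp [listEq]
    | cons o' l' => simp [listEq, orbEq, ih]

theorem listEq_time_le (l l' : List (Orb X)) : (listEq l l').time ≤ 1 + l.length * 2 := by
  induction l generalizing l' with
  | nil => cases l' <;> simp [listEq]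
  | cons o l ih =>
    cases l' with
    | nil =>
      simp only [listEq, Timed.one_time]
      omega
    | cons o' l' =>
      have := ih l'
      simp only [listEq, orbEq, Timed.bind_time, Timed.one_time, List.length_cons]
      omega

theorem mem_insertOrb (o o' : Orb X) (l : List (Orb X)) :
    o' ∈ (insertOrb o l).val ↔ o' = o ∨ o' ∈ l := by
  induction l with
  | nil => simp [insertOrb]
  | cons a l ih =>
    by_cases h : o = a
    · simp [insertOrb, orbEq, h]
    · simp [insertOrb, orbEq, h, ih, or_left_comm]

theorem nodup_insertOrb (o : Orb X) {l : List (Orb X)} (hl : l.Nodup) :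
    (insertOrb o l).val.Nodup := by
  induction l with
  | nil => simp [insertOrb]
  | cons a l ih =>
    by_cases h : o = a
    · simpa [insertOrb, orbEq, h] using hl
    · have hl' := List.nodup_cons.1 hl
      simp [insertOrb, orbEq, h, mem_insertOrb, hl'.1, ih hl'.2, Ne.symm h]

theorem length_insertOrb_le (o : Orb X) (l : List (Orb X)) :
    (insertOrb o l).val.length ≤ l.length + 1 := by
  induction l with
  | nil => simp [insertOrb]
  | cons a l ih =>
    by_cases h : o = a
    · simp [insertOrb, orbEq, h]
    · simpa [insertOrb, orbEq, h] using ih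

theorem insertOrb_time_le (o : Orb X) (l : List (Orb X)) :
    (insertOrb o l).time ≤ 2 + l.length * 2 := by
  induction l with
  | nil => simp [insertOrb]
  | cons a l ih =>
    by_cases h : o = a
    · simp only [insertOrb, orbEq, h, decide_true, Timed.bind_time, Timed.one_time, Timed.one_val,
        if_true, List.length_cons]
      omega
    · simp only [insertOrb, orbEq, h, decide_false, Timed.bind_time, Timed.one_time, Timed.one_val,
        Bool.false_eq_true, if_false, List.length_cons]
      omega

theorem mem_mapSet (f : X → Timed Y) (L : List (Orb X)) (o : Orb Y) :
    o ∈ (mapSet f L).val ↔ ∃ o' ∈ L, o = orb (f (Quotient.out o')).val := by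
  induction L with
  | nil => simp [mapSet]
  | cons a L ih => simp [mapSet, sample, toOrbit, mem_insertOrb, ih]

theorem nodup_mapSet (f : X → Timed Y) (L : List (Orb X)) : (mapSet f L).val.Nodup := by
  induction L with
  | nil => simp [mapSet]
  | cons a L ih => simpa [mapSet, sample, toOrbit] using nodup_insertOrb _ ih

theorem length_mapSet_le (f : X → Timed Y) (L : List (Orb X)) :
    (mapSet f L).val.length ≤ L.length := by
  induction L with
  | nil => simp [mapSet]
  | cons a L ih =>
    refine (length_insertOrb_le _ _).trans ?_
    simpa [sample] using ih

theorem mapSet_time_le {f : X → Timed Y} {L : List (Orb X)} {c n : ℕ}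
    (h : ∀ x, (f x).time ≤ c) (hn : L.length ≤ n) :
    (mapSet f L).time ≤ 1 + L.length * (4 + c + 2 * n) := by
  induction L with
  | nil => simp [mapSet]
  | cons a L ih =>
    rw [List.length_cons] at hn
    have h1 := h (Quotient.out a)
    have h2 := ih (by omega)
    have h3 := insertOrb_time_le (orb (f (Quotient.out a)).val) (mapSet f L).val
    have h4 := length_mapSet_le f L
    rw [List.length_cons, Nat.add_one_mul]
    simp only [mapSet, sample, toOrbit, Timed.bind_time, Timed.one_time, Timed.one_val]
    omega

end SetOperationCosts

/-! ### Product strings -/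

namespace Letter

@[simp]
theorem inLeft_L : L.inLeft = true := rfl

@[simp]
theorem inLeft_R : R.inLeft = false := rfl

@[simp]
theorem inLeft_B : B.inLeft = true := rfl

@[simp]
theorem inRight_L : L.inRight = false := rfl

@[simp]
theorem inRight_R : R.inRight = true := rfl

@[simp]
theorem inRight_B : B.inRight = true := rfl

end Letter

theorem mem_productStrings (i j : ℕ) (P : List Letter) :
    P ∈ (productStrings i j).val ↔ P.countP Letter.inLeft = i ∧ P.countP Letter.inRight = j := by
  induction i, j using productStrings.induct generalizing P with
  | case1 =>
    rw [productStrings]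
    cases P with
    | nil => simp
    | cons c P => cases c <;> simp [List.countP_cons]
  | case2 i ih =>
    rw [productStrings]
    cases P with
    | nil => simp
    | cons c P => cases c <;> simp [List.countP_cons, ih]
  | case3 j ih =>
    rw [productStrings]
    cases P with
    | nil => simp
    | cons c P => cases c <;> simp [List.countP_cons, ih]
  | case4 i j ih1 ih2 ih3 =>
    rw [productStrings]
    cases P with
    | nil => simp
    | cons c P => cases c <;> simp [List.countP_cons, ih1, ih2, ih3]

theorem nodup_productStrings (i j : ℕ) : (productStrings i j).val.Nodup := by
  have hcons : ∀ (c : Letter) {l : List (List Letter)}, l.Nodup → (l.map (c :: ·)).Nodup :=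
    fun c l hl => hl.map (List.cons_injective)
  induction i, j using productStrings.induct with
  | case1 =>
    rw [productStrings]
    simp
  | case2 i ih =>
    rw [productStrings]
    exact hcons _ ih
  | case3 j ih =>
    rw [productStrings]
    exact hcons _ ih
  | case4 i j ih1 ih2 ih3 =>
    rw [productStrings]
    refine List.nodup_append.2 ⟨hcons _ ih1, List.nodup_append.2 ⟨hcons _ ih2, hcons _ ih3, ?_⟩, ?_⟩
    · simp
    · intro P hP Q hQ
      obtain ⟨P', -, rfl⟩ := List.mem_map.1 hP
      rcases List.mem_append.1 hQ with hQ | hQ <;>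
      · obtain ⟨Q', -, rfl⟩ := List.mem_map.1 hQ
        simp

theorem length_productStrings_le (i j : ℕ) : (productStrings i j).val.length ≤ 3 ^ (i + j) := by
  induction i, j using productStrings.induct with
  | case1 =>
    rw [productStrings]
    simp
  | case2 i ih =>
    rw [productStrings]
    simp only [Timed.bind_val, List.length_map]
    refine ih.trans (Nat.pow_le_pow_right (by norm_num) (by omega))
  | case3 j ih =>
    rw [productStrings]
    simp only [Timed.bind_val, List.length_map]
    refine ih.trans (Nat.pow_le_pow_right (by norm_num) (by omega))
  | case4 i j ih1 ih2 ih3 =>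
    rw [productStrings]
    simp only [Timed.bind_val, List.length_map, List.length_append]
    rw [show i + (j + 1) = i + j + 1 by ring, pow_succ] at ih1
    rw [show i + 1 + j = i + j + 1 by ring, pow_succ] at ih2
    rw [show i + 1 + (j + 1) = i + j + 1 + 1 by ring, pow_succ, pow_succ]
    omega

theorem productStrings_time_le (i j : ℕ) : (productStrings i j).time ≤ 5 * 3 ^ (i + j) := by
  induction i, j using productStrings.induct with
  | case1 =>
    rw [productStrings]
    simp
  | case2 i ih =>
    have hl := length_productStrings_le i 0
    have h1 : 1 ≤ 3 ^ (i + 0) := Nat.one_le_pow _ _ (by norm_num)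
    rw [productStrings]
    simp only [Timed.bind_time, add_zero] at *
    rw [pow_succ]
    omega
  | case3 j ih =>
    have hl := length_productStrings_le 0 j
    have h1 : 1 ≤ 3 ^ (0 + j) := Nat.one_le_pow _ _ (by norm_num)
    rw [productStrings]
    simp only [Timed.bind_time, zero_add] at *
    rw [pow_succ]
    omega
  | case4 i j ih1 ih2 ih3 =>
    have hl1 := length_productStrings_le i (j + 1)
    have hl2 := length_productStrings_le (i + 1) j
    have hl3 := length_productStrings_le i j
    have h1 : 1 ≤ 3 ^ (i + j) := Nat.one_le_pow _ _ (by norm_num)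
    rw [productStrings]
    simp only [Timed.bind_time]
    rw [show i + (j + 1) = i + j + 1 by ring, pow_succ] at ih1 hl1
    rw [show i + 1 + j = i + j + 1 by ring, pow_succ] at ih2 hl2
    rw [show i + 1 + (j + 1) = i + j + 1 + 1 by ring, pow_succ, pow_succ]
    omega

theorem le_of_mem_positions {p : Letter → Bool} {P : List Letter} {q x : ℚ}
    (h : x ∈ positions p P q) : q ≤ x := by
  induction P generalizing q with
  | nil => simp [positions] at h
  | cons c P ih =>
    rw [positions] at h
    split_ifs at h
    · rcases Finset.mem_insert.1 h with rfl | h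
      · exact le_rfl
      · linarith [ih h]
    · linarith [ih h]

theorem notMem_positions_add_one (p : Letter → Bool) (P : List Letter) (q : ℚ) :
    q ∉ positions p P (q + 1) := fun h => by
  linarith [le_of_mem_positions h]

theorem mem_positions_cons_self {p : Letter → Bool} {c : Letter} {P : List Letter} {q : ℚ} :
    q ∈ positions p (c :: P) q ↔ p c = true := by
  rw [positions]
  split_ifs with h
  · simp [h]
  · simp [h, notMem_positions_add_one]

theorem erase_positions_cons (p : Letter → Bool) (c : Letter) (P : List Letter) (q : ℚ) :
    (positions p (c :: P) q).erase q = positions p P (q + 1) := by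
  rw [positions]
  split_ifs with h
  · exact Finset.erase_insert (notMem_positions_add_one p P q)
  · exact Finset.erase_eq_of_notMem (notMem_positions_add_one p P q)

theorem card_positions (p : Letter → Bool) (P : List Letter) (q : ℚ) :
    (positions p P q).card = P.countP p := by
  induction P generalizing q with
  | nil => simp [positions]
  | cons c P ih =>
    rw [positions]
    split_ifs with h
    · rw [Finset.card_insert_of_notMem (notMem_positions_add_one p P q), ih,
        List.countP_cons_of_pos h]
    · rw [ih, List.countP_cons_of_neg h]

theorem positions_true_congr {P P' : List Letter} (h : P.length = P'.length) (q : ℚ) :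
    positions (fun _ => true) P q = positions (fun _ => true) P' q := by
  induction P generalizing P' q with
  | nil =>
    rw [List.length_nil] at h
    rw [List.length_eq_zero_iff.1 h.symm]
  | cons c P ih =>
    cases P' with
    | nil => simp at h
    | cons c' P' =>
      rw [positions, positions, ih (by simpa using h)]

theorem positions_union (P : List Letter) (q : ℚ) :
    positions Letter.inLeft P q ∪ positions Letter.inRight P q =
      positions (fun _ => true) P q := by
  induction P generalizing q with
  | nil => simp [positions]
  | cons c P ih =>
    rw [positions, positions, positions, ← ih]
    cases c
    · simp [Finset.insert_union]
    · simp [Finset.union_insert]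
    · ext x
      simp only [Letter.inLeft_B, Letter.inRight_B, if_true, Finset.mem_union, Finset.mem_insert]
      tauto

/-- A string can be read off from the two supports that it prescribes. -/
theorem positions_injective {P P' : List Letter} {q : ℚ}
    (hl : positions Letter.inLeft P q = positions Letter.inLeft P' q)
    (hr : positions Letter.inRight P q = positions Letter.inRight P' q) : P = P' := by
  induction P generalizing P' q with
  | nil =>
    cases P' with
    | nil => rfl
    | cons c P' =>
      have h1 := mem_positions_cons_self (p := Letter.inLeft) (c := c) (P := P') (q := q)
      have h2 := mem_positions_cons_self (p := Letter.inRight) (c := c) (P := P') (q := q)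
      rw [← hl] at h1
      rw [← hr] at h2
      cases c <;> simp [positions] at h1 h2
  | cons c P ih =>
    cases P' with
    | nil =>
      have h1 := mem_positions_cons_self (p := Letter.inLeft) (c := c) (P := P) (q := q)
      have h2 := mem_positions_cons_self (p := Letter.inRight) (c := c) (P := P) (q := q)
      rw [hl] at h1
      rw [hr] at h2
      cases c <;> simp [positions] at h1 h2
    | cons c' P' =>
      have h1 : c.inLeft = true ↔ c'.inLeft = true := by
        rw [← mem_positions_cons_self, hl, mem_positions_cons_self]
      have h2 : c.inRight = true ↔ c'.inRight = true := by
        rw [← mem_positions_cons_self, hr, mem_positions_cons_self]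
      have hc : c = c' := by
        cases c <;> cases c' <;> simp_all
      have hP : P = P' := ih (q := q + 1)
        (by rw [← erase_positions_cons _ c, hl, erase_positions_cons])
        (by rw [← erase_positions_cons _ c, hr, erase_positions_cons])
      rw [hc, hP]

/-- Moving the points of a sorted list to consecutive numbers. -/
theorem exists_strictMonoOn_positions (c : ℚ → Letter) (l : List ℚ) (hl : l.Pairwise (· < ·))
    (q : ℚ) : ∃ f : ℚ → ℚ, StrictMonoOn f {x | x ∈ l} ∧ (∀ x ∈ l, q ≤ f x) ∧
      ∀ p : Letter → Bool,
        f '' {x | x ∈ l ∧ p (c x) = true} = ↑(positions p (l.map c) q) := by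
  induction l generalizing q with
  | nil => exact ⟨id, by simp [StrictMonoOn], by simp, by simp [positions]⟩
  | cons a l ih =>
    obtain ⟨ha, hl⟩ := List.pairwise_cons.1 hl
    obtain ⟨f, hf, hq, hp⟩ := ih hl (q + 1)
    have hne : ∀ x ∈ l, x ≠ a := fun x hx => (ha x hx).ne'
    have hfa : Function.update f a q a = q := Function.update_self a q f
    have hfl : ∀ x ∈ l, Function.update f a q x = f x := fun x hx =>
      Function.update_of_ne (hne x hx) q f
    refine ⟨Function.update f a q, ?_, ?_, fun p => ?_⟩
    · intro x hx y hy hxy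
      rcases List.mem_cons.1 hx with hx' | hx' <;> rcases List.mem_cons.1 hy with hy' | hy'
      · exact absurd (hx'.trans hy'.symm) hxy.ne
      · rw [hx', hfa, hfl y hy']
        linarith [hq y hy']
      · exact absurd (hy' ▸ hxy) (ha x hx').not_gt
      · rw [hfl x hx', hfl y hy']
        exact hf hx' hy' hxy
    · intro x hx
      rcases List.mem_cons.1 hx with rfl | hx
      · rw [hfa]
      · rw [hfl x hx]
        linarith [hq x hx]
    · have himg : Function.update f a q '' {x | x ∈ l ∧ p (c x) = true} =
          ↑(positions p (l.map c) (q + 1)) := by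
        rw [← hp p]
        exact Set.image_congr fun x hx => hfl x hx.1
      rw [List.map_cons, positions]
      by_cases hpa : p (c a) = true
      · have : {x | x ∈ a :: l ∧ p (c x) = true} = insert a {x | x ∈ l ∧ p (c x) = true} := by
          ext x
          simp only [List.mem_cons, Set.mem_ofPred_eq, Set.mem_insert_iff]
          constructor
          · rintro ⟨h | h, h'⟩
            · exact Or.inl h
            · exact Or.inr ⟨h, h'⟩
          · rintro (rfl | h)
            · exact ⟨Or.inl rfl, hpa⟩
            · exact ⟨Or.inr h.1, h.2⟩
        rw [this, Set.image_insert_eq, himg, hfa, if_pos hpa, Finset.coe_insert]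
      · have : {x | x ∈ a :: l ∧ p (c x) = true} = {x | x ∈ l ∧ p (c x) = true} := by
          ext x
          simp only [List.mem_cons, Set.mem_ofPred_eq]
          constructor
          · rintro ⟨rfl | h, h'⟩
            · exact absurd h' hpa
            · exact ⟨h, h'⟩
          · exact fun h => ⟨Or.inr h.1, h.2⟩
        rw [this, himg, if_neg hpa]

theorem exists_mon_image_positions (c : ℚ → Letter) (U : Finset ℚ) :
    ∃ g : Mon, ∀ p : Letter → Bool,
      g '' {x | x ∈ U ∧ p (c x) = true} = ↑(positions p ((U.sort (· ≤ ·)).map c) 0) := by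
  obtain ⟨f, hf, -, hp⟩ := exists_strictMonoOn_positions c (U.sort (· ≤ ·))
    (U.sortedLT_sort.pairwise) 0
  simp only [Finset.mem_sort] at hf hp
  obtain ⟨g, hg⟩ := exists_mon_eqOn U f hf
  refine ⟨g, fun p => ?_⟩
  rw [← hp p]
  exact Set.image_congr fun x hx => hg x hx.1

theorem exists_mon_image_eq {C D : Finset ℚ} (h : C.card = D.card) : ∃ g : Mon, g '' C = ↑D := by
  obtain ⟨g₁, h₁⟩ := exists_mon_image_positions (fun _ => Letter.B) C
  obtain ⟨g₂, h₂⟩ := exists_mon_image_positions (fun _ => Letter.B) D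
  replace h₁ := h₁ fun _ => true
  replace h₂ := h₂ fun _ => true
  rw [positions_true_congr (P' := (D.sort (· ≤ ·)).map fun _ => Letter.B) (by simp [h]),
    ← h₂] at h₁
  simp only [and_true, Finset.setOfPred_mem] at h₁ h₂
  refine ⟨g₂⁻¹ * g₁, ?_⟩
  rw [RelIso.coe_mul, Set.image_comp, h₁, ← Set.image_comp, ← RelIso.coe_mul, inv_mul_cancel]
  simp

/-! ### The orbits of a product -/

section Product

variable {X : Type u} {Y : Type v} [MulAction Mon X] [MulAction Mon Y]

theorem orb_elementAt (o : Orb X) (C : Finset ℚ) : orb (elementAt o C) = o := by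
  unfold elementAt
  split_ifs with h
  · exact h.choose_spec.1
  · exact orb_out o

theorem leastSupport_elementAt {o : Orb X} (ho : ∃ C, IsSupport C o.out) {C : Finset ℚ}
    (hC : C.card = dimElt o.out) : leastSupport (elementAt o C) = ↑C := by
  have h : ∃ x : X, orb x = o ∧ leastSupport x = ↑C := by
    obtain ⟨D, -, hD⟩ := exists_leastSupport_eq ho
    rw [dimElt, hD, Set.ncard_coe_finset] at hC
    obtain ⟨g, hg⟩ := exists_mon_image_eq hC.symm
    exact ⟨g • o.out, by rw [orb_smul, orb_out], by rw [leastSupport_smul, hD, hg]⟩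
  rw [elementAt, dif_pos h]
  exact h.choose_spec.2

theorem productOrb_val (o₁ : Orb X) (o₂ : Orb Y) (P : List Letter) :
    (productOrb o₁ o₂ P).val = orb (elementAt o₁ (positions Letter.inLeft P 0),
      elementAt o₂ (positions Letter.inRight P 0)) := rfl

theorem productSet_val (L : List (Orb X)) (L' : List (Orb Y)) :
    (productSet L L').val = L.flatMap fun o₁ => L'.flatMap fun o₂ =>
      (productStrings (dimElt o₁.out) (dimElt o₂.out)).val.map fun P =>
        (productOrb o₁ o₂ P).val := by
  simp only [productSet, Timed.flatMap_val, Timed.bind_val, Timed.map_val, orbDim, Timed.one_val]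

theorem orb_eq_of_orb_prod_eq {x x' : X} {y y' : Y} (h : orb (x, y) = orb (x', y')) :
    orb x = orb x' ∧ orb y = orb y' := by
  obtain ⟨g, hg⟩ := orb_eq_iff.1 h
  exact ⟨orb_eq_iff.2 ⟨g, congrArg Prod.fst hg⟩, orb_eq_iff.2 ⟨g, congrArg Prod.snd hg⟩⟩

theorem mem_productSet {L : List (Orb X)} {L' : List (Orb Y)}
    (hL : ∀ o ∈ L, ∃ C, IsSupport C o.out) (hL' : ∀ o ∈ L', ∃ C, IsSupport C o.out) (x : X) (y : Y) :
    orb (x, y) ∈ (productSet L L').val ↔ orb x ∈ L ∧ orb y ∈ L' := by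
  classical
  simp only [productSet_val, List.mem_flatMap, List.mem_map, productOrb_val]
  constructor
  · rintro ⟨o₁, ho₁, o₂, ho₂, P, -, h⟩
    obtain ⟨h1, h2⟩ := orb_eq_of_orb_prod_eq h
    rw [orb_elementAt] at h1 h2
    exact ⟨h1 ▸ ho₁, h2 ▸ ho₂⟩
  · rintro ⟨hx, hy⟩
    obtain ⟨C, -, hC⟩ := exists_leastSupport_eq (exists_isSupport_congr (orb_out _) (hL _ hx))
    obtain ⟨D, -, hD⟩ := exists_leastSupport_eq (exists_isSupport_congr (orb_out _) (hL' _ hy))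
    -- the string that records for each point of the joint support where it comes from
    let c : ℚ → Letter := fun q =>
      if q ∈ C then (if q ∈ D then Letter.B else Letter.L) else Letter.R
    obtain ⟨g, hg⟩ := exists_mon_image_positions c (C ∪ D)
    set P := ((C ∪ D).sort (· ≤ ·)).map c
    have hgC : leastSupport (g • x) = ↑(positions Letter.inLeft P 0) := by
      rw [leastSupport_smul, hC, ← hg]
      congr 1
      ext q
      by_cases h1 : q ∈ C <;> by_cases h2 : q ∈ D <;> simp [c, h1, h2]
    have hgD : leastSupport (g • y) = ↑(positions Letter.inRight P 0) := by
      rw [leastSupport_smul, hD, ← hg]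
      congr 1
      ext q
      by_cases h1 : q ∈ C <;> by_cases h2 : q ∈ D <;> simp [c, h1, h2]
    have hcC : (positions Letter.inLeft P 0).card = dimElt (orb x).out := by
      rw [dimElt_congr (orb_out (orb x)), ← dimElt_smul g x, dimElt, hgC, Set.ncard_coe_finset]
    have hcD : (positions Letter.inRight P 0).card = dimElt (orb y).out := by
      rw [dimElt_congr (orb_out (orb y)), ← dimElt_smul g y, dimElt, hgD, Set.ncard_coe_finset]
    refine ⟨orb x, hx, orb y, hy, P, ?_, ?_⟩
    · rw [mem_productStrings, ← card_positions _ _ 0, ← card_positions _ _ 0]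
      exact ⟨hcC, hcD⟩
    · have h1 : elementAt (orb x) (positions Letter.inLeft P 0) = g • x :=
        eq_of_orb_eq (exists_isSupport_congr ((orb_out _).trans (orb_elementAt _ _).symm)
          (hL _ hx)) (by rw [orb_elementAt, orb_smul])
          (by rw [leastSupport_elementAt (hL _ hx) hcC, hgC])
      have h2 : elementAt (orb y) (positions Letter.inRight P 0) = g • y :=
        eq_of_orb_eq (exists_isSupport_congr ((orb_out _).trans (orb_elementAt _ _).symm)
          (hL' _ hy)) (by rw [orb_elementAt, orb_smul])
          (by rw [leastSupport_elementAt (hL' _ hy) hcD, hgD])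
      rw [h1, h2, ← Prod.smul_mk, orb_smul]

/-- Different strings describe different orbits: the joint least support is an initial segment
`0, 1, …, n - 1` for every string, so a monotone bijection between two such pairs fixes it
pointwise. -/
theorem productOrb_injOn {o₁ : Orb X} {o₂ : Orb Y} (h₁ : ∃ C, IsSupport C o₁.out)
    (h₂ : ∃ C, IsSupport C o₂.out) {P P' : List Letter}
    (hP : P ∈ (productStrings (dimElt o₁.out) (dimElt o₂.out)).val)
    (hP' : P' ∈ (productStrings (dimElt o₁.out) (dimElt o₂.out)).val)
    (h : (productOrb o₁ o₂ P).val = (productOrb o₁ o₂ P').val) : P = P' := by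
  rw [mem_productStrings] at hP hP'
  rw [productOrb_val, productOrb_val] at h
  obtain ⟨g, hg⟩ := orb_eq_iff.1 h.symm
  have hl := congrArg (fun z : X × Y => leastSupport z.1) hg
  have hr := congrArg (fun z : X × Y => leastSupport z.2) hg
  dsimp only [Prod.smul_mk] at hl hr
  rw [leastSupport_smul, leastSupport_elementAt h₁ (by rw [card_positions, hP.1]),
    leastSupport_elementAt h₁ (by rw [card_positions, hP'.1])] at hl
  rw [leastSupport_smul, leastSupport_elementAt h₂ (by rw [card_positions, hP.2]),
    leastSupport_elementAt h₂ (by rw [card_positions, hP'.2])] at hr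
  have hU : g '' ↑(positions (fun _ => true) P 0) = ↑(positions (fun _ => true) P' 0) := by
    rw [← positions_union, ← positions_union, Finset.coe_union, Finset.coe_union,
      Set.image_union, hl, hr]
  have hlen : P.length = P'.length := by
    have h1 := congrArg Set.ncard hU
    rw [Set.ncard_image_of_injective _ g.injective, Set.ncard_coe_finset, Set.ncard_coe_finset,
      card_positions, card_positions] at h1
    simpa using h1
  rw [← positions_true_congr hlen] at hU
  have hfix := apply_eq_of_image_eq (Finset.finite_toSet _) g hU
  have himg : ∀ C : Finset ℚ, C ⊆ positions (fun _ => true) P 0 → g '' ↑C = ↑C := by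
    intro C hC
    have : g '' ↑C = id '' ↑C := Set.image_congr fun q hq => hfix q (hC hq)
    rwa [Set.image_id] at this
  refine positions_injective (q := 0) ?_ ?_
  · rw [himg _ (positions_union P 0 ▸ Finset.subset_union_left)] at hl
    exact_mod_cast hl
  · rw [himg _ (positions_union P 0 ▸ Finset.subset_union_right)] at hr
    exact_mod_cast hr

theorem nodup_productSet {L : List (Orb X)} {L' : List (Orb Y)} (hLn : L.Nodup) (hLn' : L'.Nodup)
    (hL : ∀ o ∈ L, ∃ C, IsSupport C o.out) (hL' : ∀ o ∈ L', ∃ C, IsSupport C o.out) :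
    (productSet L L').val.Nodup := by
  rw [productSet_val, List.nodup_flatMap]
  refine ⟨fun o₁ ho₁ => List.nodup_flatMap.2 ⟨fun o₂ ho₂ => ?_, ?_⟩, ?_⟩
  · exact (nodup_productStrings _ _).map_on fun P hP P' hP' =>
      productOrb_injOn (hL _ ho₁) (hL' _ ho₂) hP hP'
  · refine hLn'.imp fun {o₂ o₂'} hne z hz hz' => hne ?_
    obtain ⟨P, -, rfl⟩ := List.mem_map.1 hz
    obtain ⟨P', -, h⟩ := List.mem_map.1 hz'
    rw [productOrb_val, productOrb_val] at h
    have := (orb_eq_of_orb_prod_eq h).2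
    rw [orb_elementAt, orb_elementAt] at this
    exact this.symm
  · refine hLn.imp fun {o₁ o₁'} hne z hz hz' => hne ?_
    obtain ⟨o₂, -, hz⟩ := List.mem_flatMap.1 hz
    obtain ⟨o₂', -, hz'⟩ := List.mem_flatMap.1 hz'
    obtain ⟨P, -, rfl⟩ := List.mem_map.1 hz
    obtain ⟨P', -, h⟩ := List.mem_map.1 hz'
    rw [productOrb_val, productOrb_val] at h
    have := (orb_eq_of_orb_prod_eq h).1
    rw [orb_elementAt, orb_elementAt] at this
    exact this.symm

theorem length_productSet_le {L : List (Orb X)} {L' : List (Orb Y)} {a b : ℕ}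
    (hL : ∀ o ∈ L, dimElt o.out ≤ a) (hL' : ∀ o ∈ L', dimElt o.out ≤ b) :
    (productSet L L').val.length ≤ L.length * (L'.length * 3 ^ (a + b)) := by
  refine Timed.flatMap_length_le fun o₁ ho₁ => Timed.flatMap_length_le fun o₂ ho₂ => ?_
  simp only [Timed.bind_val, orbDim, Timed.one_val, Timed.map_val, List.length_map]
  exact (length_productStrings_le _ _).trans
    (Nat.pow_le_pow_right (by norm_num) (Nat.add_le_add (hL _ ho₁) (hL' _ ho₂)))

theorem productSet_time_le {L : List (Orb X)} {L' : List (Orb Y)} {a b : ℕ}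
    (hL : ∀ o ∈ L, dimElt o.out ≤ a) (hL' : ∀ o ∈ L', dimElt o.out ≤ b) :
    (productSet L L').time ≤ 1 + L.length * (2 + 15 * (L'.length * 3 ^ (a + b))) := by
  set D := 3 ^ (a + b) with hD
  have hD1 : 1 ≤ D := Nat.one_le_pow _ _ (by norm_num)
  have hpow : ∀ o₁ ∈ L, ∀ o₂ ∈ L', 3 ^ (dimElt o₁.out + dimElt o₂.out) ≤ D := fun o₁ ho₁ o₂ ho₂ =>
    Nat.pow_le_pow_right (by norm_num) (Nat.add_le_add (hL _ ho₁) (hL' _ ho₂))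
  have hlen : ∀ o₁ ∈ L, ∀ o₂ ∈ L',
      (productStrings (dimElt o₁.out) (dimElt o₂.out)).val.length ≤ D := fun o₁ ho₁ o₂ ho₂ =>
    (length_productStrings_le _ _).trans (hpow o₁ ho₁ o₂ ho₂)
  have hin : ∀ o₁ ∈ L, (Timed.flatMap (fun o₂ => (orbDim o₁).bind fun i => (orbDim o₂).bind fun j =>
      (productStrings i j).bind fun ps => Timed.map (productOrb o₁ o₂) ps) L').time ≤
      1 + L'.length * (12 * D + 1 + D) := by
    intro o₁ ho₁
    refine Timed.flatMap_time_le (fun o₂ ho₂ => ?_) (fun o₂ ho₂ => ?_)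
    · have h1 := hlen o₁ ho₁ o₂ ho₂
      have h2 := hpow o₁ ho₁ o₂ ho₂
      have h3 := productStrings_time_le (dimElt o₁.out) (dimElt o₂.out)
      have h4 := Timed.map_time_le (f := productOrb o₁ o₂) (c := 3)
        (l := (productStrings (dimElt o₁.out) (dimElt o₂.out)).val) (fun P _ => le_rfl)
      simp only [Timed.bind_time, orbDim, Timed.one_val, Timed.one_time]
      omega
    · simp only [Timed.bind_val, orbDim, Timed.one_val, Timed.map_val, List.length_map]
      exact hlen o₁ ho₁ o₂ ho₂
  refine (Timed.flatMap_time_le hin (d := L'.length * D) fun o₁ ho₁ =>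
    Timed.flatMap_length_le fun o₂ ho₂ => ?_).trans ?_
  · simp only [Timed.bind_val, orbDim, Timed.one_val, Timed.map_val, List.length_map]
    exact hlen o₁ ho₁ o₂ ho₂
  · refine Nat.add_le_add_left (Nat.mul_le_mul_left _ ?_) 1
    nlinarith [Nat.mul_le_mul_left L'.length hD1]

end Product

/-! ### Language equivalence and its approximations -/

namespace NominalDFA

variable {S : Type u} {A : Type v} [MulAction Mon S] [MulAction Mon A] (M : NominalDFA S A)

theorem smul_mem_final {g : Mon} {s : S} : g • s ∈ M.final ↔ s ∈ M.final := by
  refine ⟨fun h => ?_, M.final_equivariant g s⟩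
  have := M.final_equivariant g⁻¹ _ h
  rwa [inv_smul_smul] at this

theorem foldl_step_smul (g : Mon) (s : S) (w : List A) :
    (w.map (g • ·)).foldl M.step (g • s) = g • w.foldl M.step s := by
  induction w generalizing s with
  | nil => rfl
  | cons a w ih => rw [List.map_cons, List.foldl_cons, List.foldl_cons, M.step_equivariant, ih]

theorem foldl_step_smul_left (g : Mon) (s : S) (w : List A) :
    w.foldl M.step (g • s) = g • (w.map (g⁻¹ • ·)).foldl M.step s := by
  have hw : (w.map (g⁻¹ • ·)).map (g • ·) = w := by
    simp [List.map_map, Function.comp_def]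
  rw [← foldl_step_smul, hw]

/-- Two states are related if they accept the same words of length less than `n`. This is the
relation `≡ₙ₋₁` of Moore's algorithm. -/
def approxEquiv (n : ℕ) : Setoid S where
  r s t := ∀ w : List A, w.length < n →
    (w.foldl M.step s ∈ M.final ↔ w.foldl M.step t ∈ M.final)
  iseqv := ⟨fun _ _ _ => Iff.rfl, fun h w hw => (h w hw).symm,
    fun h h' w hw => (h w hw).trans (h' w hw)⟩

/-- Language equivalence of states. -/
def langEquiv : Setoid S := Setoid.ker M.lang

theorem approxEquiv_equivariant (n : ℕ) : IsEquivariantPartition (M.approxEquiv n) := by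
  intro g s t h w hw
  rw [foldl_step_smul_left, foldl_step_smul_left, smul_mem_final, smul_mem_final]
  exact h _ (by simpa using hw)

theorem langEquiv_iff {s t : S} : M.langEquiv s t ↔ ∀ n, M.approxEquiv n s t :=
  ⟨fun h _ w _ => Set.ext_iff.1 h w, fun h => Set.ext fun w => h (w.length + 1) w (by omega)⟩

theorem langEquiv_equivariant : IsEquivariantPartition M.langEquiv := fun g s t h =>
  M.langEquiv_iff.2 fun n => M.approxEquiv_equivariant n g s t (M.langEquiv_iff.1 h n)

theorem eqvClass_langEquiv (s : S) : eqvClass M.langEquiv s = M.langClass s :=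
  Set.ext fun _ => eq_comm

theorem smul_langClass (g : Mon) (s : S) : g • M.langClass s = M.langClass (g • s) := by
  rw [← eqvClass_langEquiv, ← eqvClass_langEquiv, smul_eqvClass M.langEquiv_equivariant]

theorem langClass_eq_iff {s t : S} : M.langClass s = M.langClass t ↔ M.lang s = M.lang t := by
  rw [← eqvClass_langEquiv, ← eqvClass_langEquiv, eqvClass_eq_iff]
  rfl

theorem mem_final_of_lang_eq {s t : S} (h : M.lang s = M.lang t) (hs : s ∈ M.final) :
    t ∈ M.final := (Set.ext_iff.1 h []).1 hs

theorem lang_step_eq {s t : S} (h : M.lang s = M.lang t) (a : A) :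
    M.lang (M.step s a) = M.lang (M.step t a) := Set.ext fun w => Set.ext_iff.1 h (a :: w)

theorem approxEquiv_zero (s t : S) : M.approxEquiv 0 s t := fun w hw => absurd hw (by simp)

theorem approxEquiv_one {s t : S} : M.approxEquiv 1 s t ↔ (s ∈ M.final ↔ t ∈ M.final) :=
  ⟨fun h => h [] (by simp), fun h w hw => by
    rw [List.length_eq_zero_iff.1 (Nat.lt_one_iff.1 hw)]
    exact h⟩

theorem approxEquiv_anti {m n : ℕ} (h : m ≤ n) : M.approxEquiv n ≤ M.approxEquiv m :=
  fun _ _ hst w hw => hst w (hw.trans_le h)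

theorem approxEquiv_add_two {n : ℕ} {s t : S} : M.approxEquiv (n + 2) s t ↔
    M.approxEquiv (n + 1) s t ∧ ∀ a, M.approxEquiv (n + 1) (M.step s a) (M.step t a) := by
  refine ⟨fun h => ⟨M.approxEquiv_anti (by omega) h, fun a w hw => ?_⟩, fun h w hw => ?_⟩
  · exact h (a :: w) (by rw [List.length_cons]; omega)
  · cases w with
    | nil => exact h.1 [] (by simp)
    | cons a w => exact h.2 a w (by rw [List.length_cons] at hw; omega)

theorem langEquiv_eq_of_stable {n : ℕ} (h : M.approxEquiv n = M.approxEquiv (n + 1)) :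
    M.langEquiv = M.approxEquiv n := by
  have key : ∀ m, M.approxEquiv n ≤ M.approxEquiv (n + m + 1) := by
    intro m
    induction m with
    | zero => exact h.le
    | succ m ih =>
      intro s t hst
      refine M.approxEquiv_add_two.2 ⟨ih hst, fun a => ih ?_⟩
      cases n with
      | zero => exact M.approxEquiv_zero _ _
      | succ n => exact (M.approxEquiv_add_two.1 (h.le hst)).2 a
  refine le_antisymm (fun s t hst => M.langEquiv_iff.1 hst n) fun s t hst =>
    M.langEquiv_iff.2 fun m => ?_
  exact M.approxEquiv_anti (by omega) (key m hst)

/-- The approximations become stationary after at most as many steps as the potential allows. -/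
theorem exists_stable (hS : OrbitFiniteNominal S) :
    ∃ n ≤ 2 * (max 1 (dim S) * max 1 (numOrb S)), M.approxEquiv n = M.approxEquiv (n + 1) ∧
      ∀ i < n, M.approxEquiv i ≠ M.approxEquiv (i + 1) := by
  classical
  have key : ∀ n, (∀ i < n, M.approxEquiv i ≠ M.approxEquiv (i + 1)) →
      n ≤ potential (M.approxEquiv n) := by
    intro n
    induction n with
    | zero => intro _; exact Nat.zero_le _
    | succ n ih =>
      intro h
      have h1 := ih fun i hi => h i (by omega)
      have h2 := potential_lt hS (M.approxEquiv_equivariant n) (M.approxEquiv_equivariant (n + 1))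
        (lt_of_le_of_ne (M.approxEquiv_anti (by omega)) (h n (by omega)).symm)
      omega
  have hex : ∃ n, M.approxEquiv n = M.approxEquiv (n + 1) := by
    by_contra! h
    have h1 := key (2 * (max 1 (dim S) * max 1 (numOrb S)) + 1) fun i _ => h i
    have h2 := potential_le_max hS
      (M.approxEquiv_equivariant (2 * (max 1 (dim S) * max 1 (numOrb S)) + 1))
    omega
  exact ⟨Nat.find hex, (key _ fun i hi => Nat.find_min hex hi).trans
    (potential_le_max hS (M.approxEquiv_equivariant _)), Nat.find_spec hex,
    fun i hi => Nat.find_min hex hi⟩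

end NominalDFA

/-! ### The loop -/

theorem callPred_val_iff {Z : Type w} {p : Z → Prop} {z : Z} :
    (callPred p z).val = true ↔ p z :=
  @decide_eq_true_iff _ (Classical.propDecidable _)

/-- A loop that passes through the states `f 0, f 1, …, f n`. -/
theorem WhileRuns.exists_of_sequence {σ : Type u} {test : σ → Timed Bool} {body : σ → Timed σ}
    {a b : ℕ} (n : ℕ) (f : ℕ → σ) (htest : ∀ i < n, (test (f i)).val = true)
    (hbody : ∀ i < n, (body (f i)).val = f (i + 1)) (hend : (test (f n)).val = false)
    (ha : ∀ i, (test (f i)).time ≤ a) (hb : ∀ i, (body (f i)).time ≤ b) :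
    ∃ t ≤ (n + 1) * (a + b), WhileRuns test body (f 0) (f n) t := by
  induction n generalizing f with
  | zero => exact ⟨_, by have := ha 0; omega, WhileRuns.done _ hend⟩
  | succ n ih =>
    obtain ⟨t, ht, hrun⟩ := ih (fun i => f (i + 1)) (fun i hi => htest _ (by omega))
      (fun i hi => hbody _ (by omega)) hend (fun i => ha _) (fun i => hb _)
    refine ⟨_, ?_, WhileRuns.next (f 0) _ t (htest 0 (by omega)) ?_⟩
    · have h1 := ha 0
      have h2 := hb 0
      rw [Nat.add_one_mul (n + 1)]
      omega
    · rw [hbody 0 (by omega)]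
      exact hrun

section Relations

variable {S : Type u} {A : Type v} [MulAction Mon S] [MulAction Mon A]

open Classical in
/-- The orbits in `SS` of the pairs related by `r`. -/
noncomputable def relList (r : Setoid S) (SS : List (Orb (S × S))) : List (Orb (S × S)) :=
  SS.filter fun o => decide (r o.out.1 o.out.2)

theorem rel_out_iff {r : Setoid S} (hr : IsEquivariantPartition r) (s t : S) :
    r (Quotient.out (orb (s, t))).1 (Quotient.out (orb (s, t))).2 ↔ r s t := by
  obtain ⟨g, hg⟩ := orb_eq_iff.1 (orb_out (orb (s, t)))
  rw [← hg]
  refine ⟨fun h => ?_, hr g s t⟩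
  have := hr g⁻¹ _ _ h
  rwa [Prod.smul_fst, Prod.smul_snd, inv_smul_smul, inv_smul_smul] at this

theorem mem_relList {r : Setoid S} (hr : IsEquivariantPartition r) {SS : List (Orb (S × S))}
    (hSS : Represents SS) (s t : S) : orb (s, t) ∈ relList r SS ↔ r s t := by
  classical
  rw [relList, List.mem_filter, decide_eq_true_iff, rel_out_iff hr]
  exact and_iff_right (hSS.2 _)

theorem relList_injective {r r' : Setoid S} (hr : IsEquivariantPartition r)
    (hr' : IsEquivariantPartition r') {SS : List (Orb (S × S))} (hSS : Represents SS)
    (h : relList r SS = relList r' SS) : r = r' :=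
  Setoid.ext fun s t => by rw [← mem_relList hr hSS, h, mem_relList hr' hSS]

theorem length_relList_le (r : Setoid S) (SS : List (Orb (S × S))) :
    (relList r SS).length ≤ SS.length := List.length_filter_le _ _

theorem relList_approxEquiv_zero (M : NominalDFA S A) (SS : List (Orb (S × S))) :
    relList (M.approxEquiv 0) SS = SS := by
  classical
  exact List.filter_eq_self.2 fun _ _ => decide_eq_true (M.approxEquiv_zero _ _)

theorem initialRel_val (M : NominalDFA S A) (SS : List (Orb (S × S))) :
    (initialRel M SS).val = relList (M.approxEquiv 1) SS := by
  classical
  rw [initialRel, filterSet, Timed.filter_val, relList]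
  refine List.filter_congr fun o _ => ?_
  rw [Bool.eq_iff_iff, decide_eq_true_iff, M.approxEquiv_one]
  simp only [sample, Timed.bind_val, Timed.one_val]
  rw [beq_iff_eq, Bool.eq_iff_iff, callPred_val_iff, callPred_val_iff]

/-- The test of `refine` on an orbit of the current relation. -/
noncomputable def refineTest (M : NominalDFA S A) (LA : List (Orb A)) (R : List (Orb (S × S)))
    (o : Orb (S × S)) : Timed Bool :=
  (productSet [o] LA).bind fun T => Timed.all (fun t => (sample t).bind (checkTriple M R)) T

theorem refine_eq (M : NominalDFA S A) (LA : List (Orb A)) (R : List (Orb (S × S))) :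
    refine M LA R = Timed.filter (refineTest M LA R) R := rfl

theorem checkTriple_val_iff (M : NominalDFA S A) (R : List (Orb (S × S))) (x : (S × S) × A) :
    (checkTriple M R x).val = true ↔ orb (M.step x.1.1 x.2, M.step x.1.2 x.2) ∈ R :=
  callPred_val_iff

theorem refineTest_val_iff (M : NominalDFA S A) {LA : List (Orb A)} (hLA : Represents LA)
    (hS : OrbitFiniteNominal S) (hA : OrbitFiniteNominal A) {R : List (Orb (S × S))} {n : ℕ}
    (hR : ∀ s t, orb (s, t) ∈ R ↔ M.approxEquiv (n + 1) s t) {o : Orb (S × S)}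
    (ho : M.approxEquiv (n + 1) o.out.1 o.out.2) :
    (refineTest M LA R o).val = true ↔ M.approxEquiv (n + 2) o.out.1 o.out.2 := by
  have hmem : ∀ (x : S × S) (a : A), orb (x, a) ∈ (productSet [o] LA).val ↔ orb x = o := by
    intro x a
    rw [mem_productSet (fun o _ => ?_) (fun o _ => hA.nominal _), List.mem_singleton]
    · exact and_iff_left (hLA.2 _)
    · exact exists_isSupport_prod (hS.nominal _) (hS.nominal _)
  simp only [refineTest, Timed.bind_val, Timed.all_val, List.all_eq_true, sample, Timed.one_val,
    checkTriple_val_iff, hR]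
  rw [M.approxEquiv_add_two, and_iff_right ho]
  constructor
  · intro h a
    have h1 := h (orb (o.out, a)) ((hmem _ _).2 (orb_out o))
    obtain ⟨g, hg⟩ := orb_eq_iff.1 (orb_out (orb (o.out, a)))
    rw [← hg] at h1
    simp only [Prod.smul_fst, Prod.smul_snd, M.step_equivariant] at h1
    have h2 := M.approxEquiv_equivariant (n + 1) g⁻¹ _ _ h1
    rwa [inv_smul_smul, inv_smul_smul] at h2
  · intro h t ht
    have h1 : orb (Quotient.out t).1 = o := by
      rw [← hmem _ (Quotient.out t).2, Prod.mk.eta, orb_out]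
      exact ht
    obtain ⟨g, hg⟩ := orb_eq_iff.1 (h1.trans (orb_out o).symm)
    have h2 := M.approxEquiv_equivariant (n + 2) g _ _ (M.approxEquiv_add_two.2 ⟨ho, h⟩)
    rw [← Prod.smul_fst, ← Prod.smul_snd, hg] at h2
    exact (M.approxEquiv_add_two.1 h2).2 _

/-- One pass of the loop computes the next approximation. -/
theorem refine_val (M : NominalDFA S A) {LA : List (Orb A)} (hLA : Represents LA)
    (hS : OrbitFiniteNominal S) (hA : OrbitFiniteNominal A) {SS : List (Orb (S × S))}
    (hSS : Represents SS) (n : ℕ) :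
    (refine M LA (relList (M.approxEquiv (n + 1)) SS)).val =
      relList (M.approxEquiv (n + 2)) SS := by
  classical
  have key := fun o => refineTest_val_iff M hLA hS hA
    (mem_relList (M.approxEquiv_equivariant (n + 1)) hSS) (o := o)
  rw [refine_eq, Timed.filter_val]
  generalize refineTest M LA (relList (M.approxEquiv (n + 1)) SS) = p at key ⊢
  rw [relList, relList, List.filter_filter]
  refine List.filter_congr fun o _ => ?_
  rw [Bool.eq_iff_iff, Bool.and_eq_true, decide_eq_true_iff, decide_eq_true_iff]
  exact ⟨fun h => (key o h.2).1 h.1, fun h =>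
    ⟨(key o (M.approxEquiv_anti (by omega) h)).2 h, M.approxEquiv_anti (by omega) h⟩⟩

theorem refine_time_le (M : NominalDFA S A) {LA : List (Orb A)} (R : List (Orb (S × S))) {k : ℕ}
    (hR : ∀ o ∈ R, dimElt o.out ≤ 2 * k) (hA : ∀ o ∈ LA, dimElt o.out ≤ k) :
    (refine M LA R).time ≤ 1 + R.length * (5 + 21 * (LA.length * 3 ^ (3 * k))) := by
  rw [show 3 * k = 2 * k + k by ring]
  refine Timed.filter_time_le (c := 4 + 21 * (LA.length * 3 ^ (2 * k + k))) (fun o ho => ?_)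
    |>.trans (Nat.add_le_add_left (Nat.mul_le_mul_left _ (by omega)) _)
  have ho' : ∀ o' ∈ [o], dimElt o'.out ≤ 2 * k := fun o' h => List.mem_singleton.1 h ▸ hR o ho
  have h1 := productSet_time_le ho' hA
  have h2 := length_productSet_le ho' hA
  have h3 := Timed.all_time_le (c := 5) (l := (productSet [o] LA).val)
    (p := fun t => (sample t).bind (checkTriple M R)) fun t _ => le_rfl
  simp only [List.length_singleton, one_mul] at h1 h2
  simp only [Timed.bind_time]
  omega

end Relations

/-! ### The quotient automaton -/

theorem pick_val_of_nonempty {S : Type u} {e : Set S} (h : e.Nonempty) : (pick e).val = some h.some :=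
  dif_pos h

theorem pick_val_of_not_nonempty {S : Type u} {e : Set S} (h : ¬ e.Nonempty) : (pick e).val = none :=
  dif_neg h

theorem pick_time {S : Type u} (e : Set S) : (pick e).time = 1 := rfl

section Quotient

variable {S : Type u} {A : Type v} [MulAction Mon S] [MulAction Mon A]

theorem classOf_val (R : List (Orb (S × S))) (s : S) :
    (classOf R s).val = {t | orb (s, t) ∈ R} := by
  induction R with
  | nil => simp [classOf]
  | cons o R ih =>
    simp only [classOf, Timed.bind_val, Timed.one_val, ih, List.mem_cons]
    rfl

theorem classOf_time (R : List (Orb (S × S))) (s : S) : (classOf R s).time = R.length + 1 := by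
  induction R with
  | nil => rfl
  | cons o R ih => simp [classOf, ih]

theorem classOf_val_eq_langClass {M : NominalDFA S A} {R : List (Orb (S × S))}
    (hR : ∀ s t, orb (s, t) ∈ R ↔ M.lang s = M.lang t) (s : S) :
    (classOf R s).val = M.langClass s := by
  rw [classOf_val]
  ext t
  exact (hR s t).trans eq_comm

theorem orb_mem_quotientStates {M : NominalDFA S A} {LS : List (Orb S)} (hLS : Represents LS)
    {R : List (Orb (S × S))} (hR : ∀ s t, orb (s, t) ∈ R ↔ M.lang s = M.lang t) (e : Set S) :
    orb e ∈ (quotientStates LS R).val ↔ ∃ s, e = M.langClass s := by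
  rw [quotientStates, mem_mapSet]
  simp only [classOf_val_eq_langClass hR]
  constructor
  · rintro ⟨o, -, h⟩
    obtain ⟨g, rfl⟩ := orb_eq_iff.1 h
    exact ⟨g • o.out, M.smul_langClass g _⟩
  · rintro ⟨s, rfl⟩
    refine ⟨orb s, hLS.2 _, ?_⟩
    obtain ⟨g, hg⟩ := orb_eq_iff.1 (orb_out (orb s))
    rw [← hg, ← M.smul_langClass, orb_smul]

theorem orb_mem_quotientFinal {M : NominalDFA S A} {E : List (Orb (Set S))}
    (hE : ∀ e, orb e ∈ E ↔ ∃ s, e = M.langClass s) (e : Set S) :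
    orb e ∈ (quotientFinal M E).val ↔ ∃ s ∈ M.final, e = M.langClass s := by
  have key : ∀ s, (∀ t ∈ M.langClass s, t ∈ M.final) ↔ s ∈ M.final := fun s =>
    ⟨fun h => h s rfl, fun h t ht => M.mem_final_of_lang_eq (Eq.symm ht) h⟩
  rw [quotientFinal, filterSet, Timed.filter_val, List.mem_filter, hE]
  simp only [sample, Timed.bind_val, Timed.one_val, callPred_val_iff]
  obtain ⟨g, hg⟩ := orb_eq_iff.1 (orb_out (orb e))
  rw [← hg]
  constructor
  · rintro ⟨⟨s, rfl⟩, h⟩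
    rw [M.smul_langClass, key, M.smul_mem_final] at h
    exact ⟨s, h, rfl⟩
  · rintro ⟨s, hs, rfl⟩
    refine ⟨⟨s, rfl⟩, ?_⟩
    rw [M.smul_langClass, key, M.smul_mem_final]
    exact hs

/-- The work of `quotientStep` on one orbit of `E × A`. -/
noncomputable def stepOrbit (M : NominalDFA S A) (R : List (Orb (S × S))) (o : Orb (Set S × A)) :
    Timed (List (Orb ((Set S × A) × Set S))) :=
  (sample o).bind fun x => (pick x.1).bind fun s? =>
    match s? with
    | none => Timed.one []
    | some s =>
      (call (fun y : S × A => M.step y.1 y.2) (s, x.2)).bind fun q =>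
      (classOf R q).bind fun e' => (toOrbit (x, e')).bind fun r => Timed.one [r]

theorem quotientStep_eq (M : NominalDFA S A) (LA : List (Orb A)) (R : List (Orb (S × S)))
    (E : List (Orb (Set S))) : quotientStep M LA R E =
      (productSet E LA).bind fun EA => Timed.flatMap (stepOrbit M R) EA := rfl

theorem stepOrbit_val {M : NominalDFA S A} {R : List (Orb (S × S))}
    (hR : ∀ s t, orb (s, t) ∈ R ↔ M.lang s = M.lang t) {o : Orb (Set S × A)} {s : S}
    (ho : (Quotient.out o).1 = M.langClass s) :
    (stepOrbit M R o).val =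
      [orb (Quotient.out o, M.langClass (M.step s (Quotient.out o).2))] := by
  have hne : (Quotient.out o).1.Nonempty := ⟨s, ho ▸ rfl⟩
  have hmem : hne.some ∈ M.langClass s := ho ▸ hne.some_mem
  have hcls : M.langClass (M.step hne.some (Quotient.out o).2) =
      M.langClass (M.step s (Quotient.out o).2) :=
    M.langClass_eq_iff.2 (M.lang_step_eq hmem _)
  simp only [stepOrbit, sample, pick_val_of_nonempty hne, call, toOrbit, Timed.bind_val,
    Timed.one_val, classOf_val_eq_langClass hR, hcls]

theorem stepOrbit_time_le (M : NominalDFA S A) (R : List (Orb (S × S))) (o : Orb (Set S × A)) :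
    (stepOrbit M R o).time ≤ R.length + 6 := by
  by_cases hne : (Quotient.out o).1.Nonempty
  · simp only [stepOrbit, sample, pick_val_of_nonempty hne, pick_time, call, toOrbit,
      Timed.bind_time, Timed.one_time, Timed.one_val, classOf_time]
    omega
  · simp only [stepOrbit, sample, pick_val_of_not_nonempty hne, pick_time, Timed.bind_time,
      Timed.one_time, Timed.one_val]
    omega

theorem length_stepOrbit_le (M : NominalDFA S A) (R : List (Orb (S × S))) (o : Orb (Set S × A)) :
    (stepOrbit M R o).val.length ≤ 1 := by
  by_cases hne : (Quotient.out o).1.Nonempty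
  · simp [stepOrbit, sample, pick_val_of_nonempty hne]
  · simp [stepOrbit, sample, pick_val_of_not_nonempty hne]

section

variable {M : NominalDFA S A} {LA : List (Orb A)} {R : List (Orb (S × S))} {E : List (Orb (Set S))}

theorem exists_isSupport_out_of_mem (hS : OrbitFiniteNominal S)
    (hE : ∀ e, orb e ∈ E ↔ ∃ s, e = M.langClass s) : ∀ o ∈ E, ∃ C, IsSupport C o.out := by
  intro o ho
  rw [← orb_out o, hE] at ho
  obtain ⟨s, hs⟩ := ho
  rw [hs, ← M.eqvClass_langEquiv]
  exact exists_isSupport_eqvClass M.langEquiv_equivariant (hS.nominal s)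

theorem dimElt_out_le_of_mem (hS : OrbitFiniteNominal S)
    (hE : ∀ e, orb e ∈ E ↔ ∃ s, e = M.langClass s) : ∀ o ∈ E, dimElt o.out ≤ dim S := by
  intro o ho
  rw [← orb_out o, hE] at ho
  obtain ⟨s, hs⟩ := ho
  rw [hs, ← M.eqvClass_langEquiv]
  exact (dimElt_eqvClass_le M.langEquiv_equivariant (hS.nominal s)).trans (dimElt_le_dim hS s)

theorem orb_mem_productSet_classes (hS : OrbitFiniteNominal S) (hA : OrbitFiniteNominal A)
    (hLA : Represents LA) (hE : ∀ e, orb e ∈ E ↔ ∃ s, e = M.langClass s) (e : Set S) (a : A) :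
    orb (e, a) ∈ (productSet E LA).val ↔ ∃ s, e = M.langClass s := by
  rw [mem_productSet (exists_isSupport_out_of_mem hS hE) (fun o _ => hA.nominal _), hE]
  exact and_iff_left (hLA.2 _)

theorem exists_out_eq_langClass (hS : OrbitFiniteNominal S) (hA : OrbitFiniteNominal A)
    (hLA : Represents LA) (hE : ∀ e, orb e ∈ E ↔ ∃ s, e = M.langClass s)
    {o : Orb (Set S × A)} (ho : o ∈ (productSet E LA).val) :
    ∃ s, (Quotient.out o).1 = M.langClass s := by
  rwa [← orb_mem_productSet_classes hS hA hLA hE _ (Quotient.out o).2, Prod.mk.eta, orb_out]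

theorem nodup_quotientStep (hS : OrbitFiniteNominal S) (hA : OrbitFiniteNominal A)
    (hLA : Represents LA) (hR : ∀ s t, orb (s, t) ∈ R ↔ M.lang s = M.lang t)
    (hE : ∀ e, orb e ∈ E ↔ ∃ s, e = M.langClass s) (hEn : E.Nodup) :
    (quotientStep M LA R E).val.Nodup := by
  rw [quotientStep_eq, Timed.bind_val, Timed.flatMap_val, List.nodup_flatMap]
  constructor
  · intro o ho
    obtain ⟨s, hs⟩ := exists_out_eq_langClass hS hA hLA hE ho
    rw [stepOrbit_val hR hs]
    exact List.nodup_singleton _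
  · have hn := nodup_productSet hEn hLA.1 (exists_isSupport_out_of_mem hS hE)
      (fun o _ => hA.nominal _)
    refine List.Pairwise.imp_of_mem (fun {o o'} ho ho' hne z hz hz' => hne ?_) hn
    obtain ⟨s, hs⟩ := exists_out_eq_langClass hS hA hLA hE ho
    obtain ⟨s', hs'⟩ := exists_out_eq_langClass hS hA hLA hE ho'
    dsimp only at hz hz'
    rw [stepOrbit_val hR hs, List.mem_singleton] at hz
    rw [stepOrbit_val hR hs', List.mem_singleton, hz] at hz'
    have := (orb_eq_of_orb_prod_eq hz').1
    rwa [orb_out, orb_out] at this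

theorem orb_mem_quotientStep (hS : OrbitFiniteNominal S) (hA : OrbitFiniteNominal A)
    (hLA : Represents LA) (hR : ∀ s t, orb (s, t) ∈ R ↔ M.lang s = M.lang t)
    (hE : ∀ e, orb e ∈ E ↔ ∃ s, e = M.langClass s) (e : Set S) (a : A) (e' : Set S) :
    orb ((e, a), e') ∈ (quotientStep M LA R E).val ↔
      ∃ s, e = M.langClass s ∧ e' = M.langClass (M.step s a) := by
  rw [quotientStep_eq, Timed.bind_val, Timed.flatMap_val, List.mem_flatMap]
  constructor
  · rintro ⟨o, ho, h⟩
    obtain ⟨s, hs⟩ := exists_out_eq_langClass hS hA hLA hE ho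
    rw [stepOrbit_val hR hs, List.mem_singleton] at h
    obtain ⟨g, hg⟩ := orb_eq_iff.1 h
    have h1 : g • (Quotient.out o).1 = e := congrArg (fun z => z.1.1) hg
    have h2 : g • (Quotient.out o).2 = a := congrArg (fun z => z.1.2) hg
    have h3 : g • M.langClass (M.step s (Quotient.out o).2) = e' := congrArg (fun z => z.2) hg
    refine ⟨g • s, ?_, ?_⟩
    · rw [← h1, hs, M.smul_langClass]
    · rw [← h3, ← h2, M.smul_langClass, M.step_equivariant]
  · rintro ⟨s, rfl, rfl⟩
    refine ⟨orb (M.langClass s, a),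
      (orb_mem_productSet_classes hS hA hLA hE _ _).2 ⟨s, rfl⟩, ?_⟩
    obtain ⟨g, hg⟩ := orb_eq_iff.1 (orb_out (orb (M.langClass s, a)))
    have h1 : (Quotient.out (orb (M.langClass s, a))).1 = M.langClass (g • s) := by
      rw [← hg, Prod.smul_fst, M.smul_langClass]
    rw [stepOrbit_val hR h1, List.mem_singleton, ← hg, Prod.smul_snd, M.step_equivariant,
      ← M.smul_langClass, ← Prod.smul_mk, orb_smul]

end

/-- The part after the loop yields the minimal automaton. -/
theorem isMinimisation_mooreFinish {M : NominalDFA S A} {LS : List (Orb S)} {LA : List (Orb A)}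
    {R : List (Orb (S × S))} (hS : OrbitFiniteNominal S) (hA : OrbitFiniteNominal A)
    (hLS : Represents LS) (hLA : Represents LA) (hRn : R.Nodup)
    (hR : ∀ s t, orb (s, t) ∈ R ↔ M.lang s = M.lang t) :
    IsMinimisation M (mooreFinish M LS LA R).val := by
  have hE := orb_mem_quotientStates hLS hR
  have hEn : (quotientStates LS R).val.Nodup := nodup_mapSet _ _
  exact
    { rel_nodup := hRn
      rel_iff := hR
      states_nodup := hEn
      states_iff := hE
      final_nodup := by
        have : (quotientFinal M (quotientStates LS R).val).val.Nodup := by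
          rw [quotientFinal, filterSet, Timed.filter_val]
          exact hEn.filter _
        exact this
      final_iff := orb_mem_quotientFinal hE
      step_nodup := nodup_quotientStep hS hA hLA hR hE hEn
      step_iff := orb_mem_quotientStep hS hA hLA hR hE }

theorem mooreFinish_time_le {M : NominalDFA S A} {LS : List (Orb S)} {LA : List (Orb A)}
    {R : List (Orb (S × S))} (hS : OrbitFiniteNominal S) (hLS : Represents LS)
    (hR : ∀ s t, orb (s, t) ∈ R ↔ M.lang s = M.lang t) {k : ℕ} (hk : dim S ≤ k)
    (hAk : ∀ o ∈ LA, dimElt o.out ≤ k) :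
    (mooreFinish M LS LA R).time ≤
      (1 + LS.length * (5 + R.length + 2 * LS.length)) + (1 + LS.length * 3) +
      (1 + LS.length * (2 + 15 * (LA.length * 3 ^ (2 * k)))) +
      (1 + LS.length * (LA.length * 3 ^ (2 * k)) * (R.length + 8)) + 1 := by
  have hE := orb_mem_quotientStates hLS hR
  have hEk : ∀ o ∈ (quotientStates LS R).val, dimElt o.out ≤ k := fun o ho =>
    (dimElt_out_le_of_mem hS hE o ho).trans hk
  have hElen : (quotientStates LS R).val.length ≤ LS.length := length_mapSet_le _ _
  have h1 : (quotientStates LS R).time ≤ 1 + LS.length * (4 + (R.length + 1) + 2 * LS.length) :=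
    mapSet_time_le (fun s => (classOf_time R s).le) le_rfl
  have h2 : (quotientFinal M (quotientStates LS R).val).time ≤
      1 + (quotientStates LS R).val.length * (2 + 1) := Timed.filter_time_le fun o _ => le_rfl
  have h3 := productSet_time_le hEk hAk
  have h4 := length_productSet_le hEk hAk
  have h5 : (Timed.flatMap (stepOrbit M R) (productSet (quotientStates LS R).val LA).val).time ≤ _ :=
    Timed.flatMap_time_le (fun o _ => stepOrbit_time_le M R o) (fun o _ => length_stepOrbit_le M R o)
  rw [← two_mul] at h3 h4
  have h6 := Nat.mul_le_mul_right (2 + 15 * (LA.length * 3 ^ (2 * k))) hElen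
  have h7 := Nat.mul_le_mul_right (R.length + 6 + 1 + 1)
    (h4.trans (Nat.mul_le_mul_right (LA.length * 3 ^ (2 * k)) hElen))
  rw [show 4 + (R.length + 1) + 2 * LS.length = 5 + R.length + 2 * LS.length by ring] at h1
  rw [show R.length + 6 + 1 + 1 = R.length + 8 by ring] at h5 h7
  simp only [mooreFinish, quotientStep_eq, Timed.bind_time, Timed.one_time]
  omega

end Quotient

/-! ### Correctness and running time of Moore's algorithm -/

section Moore

variable {S : Type u} {A : Type v} [MulAction Mon S] [MulAction Mon A]

theorem Represents.length_eq {L : List (Orb S)} (h : Represents L) : L.length = numOrb S := by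
  classical
  rw [numOrb, ← List.toFinset_card_of_nodup h.1]
  exact (Nat.subtype_card (p := fun _ => True) L.toFinset (by simp [h.2])).symm.trans
    (Nat.card_congr (Equiv.Set.univ _))

theorem represents_productSet (hS : OrbitFiniteNominal S) (hA : OrbitFiniteNominal A)
    {LS : List (Orb S)} {LA : List (Orb A)} (hLS : Represents LS) (hLA : Represents LA) :
    Represents (productSet LS LA).val := by
  refine ⟨nodup_productSet hLS.1 hLA.1 (fun o _ => hS.nominal _) (fun o _ => hA.nominal _),
    fun o => ?_⟩
  rw [← orb_out o, ← Prod.mk.eta (p := Quotient.out o),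
    mem_productSet (fun o _ => hS.nominal _) (fun o _ => hA.nominal _)]
  exact ⟨hLS.2 _, hLA.2 _⟩

/-- Adding up the times of the parts: `L` bounds the length of the lists of orbits of `S × S` and
`n` the number of passes of the loop. -/
theorem total_time_le {N m N' m' k' D₂ D₃ L n : ℕ} (hN' : 1 ≤ N') (hm' : 1 ≤ m') (hk' : 1 ≤ k')
    (hD₂ : 1 ≤ D₂) (hD : D₂ ≤ D₃) (hN : N ≤ N') (hm : m ≤ m') (hL : L ≤ N * (N * D₂))
    (hn : n ≤ 2 * (k' * N')) :
    ((1 + N * (2 + 15 * (N * D₂))) + (1 + L * 5) + 1) +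
      (n + 1) * ((2 + L * 2) + (2 + L * (5 + 21 * (m * D₃)))) +
      ((1 + N * (5 + L + 2 * N)) + (1 + N * 3) + (1 + N * (2 + 15 * (m * D₂))) +
        (1 + N * (m * D₂) * (L + 8)) + 1) ≤
      200 * (D₂ * D₃ * k' * N' ^ 3 * m') := by
  have hL' : L ≤ N' * (N' * D₂) := hL.trans (by gcongr)
  have hlhs : ((1 + N * (2 + 15 * (N * D₂))) + (1 + L * 5) + 1) +
      (n + 1) * ((2 + L * 2) + (2 + L * (5 + 21 * (m * D₃)))) +
      ((1 + N * (5 + L + 2 * N)) + (1 + N * 3) + (1 + N * (2 + 15 * (m * D₂))) +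
        (1 + N * (m * D₂) * (L + 8)) + 1) ≤
      ((1 + N' * (2 + 15 * (N' * D₂))) + (1 + N' * (N' * D₂) * 5) + 1) +
      (2 * (k' * N') + 1) * ((2 + N' * (N' * D₂) * 2) +
        (2 + N' * (N' * D₂) * (5 + 21 * (m' * D₃)))) +
      ((1 + N' * (5 + N' * (N' * D₂) + 2 * N')) + (1 + N' * 3) + (1 + N' * (2 + 15 * (m' * D₃))) +
        (1 + N' * (m' * D₃) * (N' * (N' * D₂) + 8)) + 1) := by
    gcongr
  refine hlhs.trans ?_
  have hV : 1 ≤ m' * D₃ := Nat.mul_pos hm' (hD₂.trans hD)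
  have hND : N' ≤ N' * D₂ := Nat.le_mul_of_pos_right _ hD₂
  have hQ : N' * D₂ ≤ N' * (N' * D₂) := Nat.le_mul_of_pos_left _ hN'
  have hK : N' ≤ k' * N' := Nat.le_mul_of_pos_left _ hk'
  rw [show D₂ * D₃ * k' * N' ^ 3 * m' = (N' * (N' * D₂)) * (m' * D₃) * (k' * N') by ring]
  generalize N' * (N' * D₂) = Q at *
  generalize m' * D₃ = V at *
  generalize k' * N' = K at *
  generalize N' * D₂ = P at *
  have hQ1 : 1 ≤ Q := by omega
  have t1 : K * Q ≤ Q * V * K := by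
    rw [show Q * V * K = K * Q * V by ring]
    exact Nat.le_mul_of_pos_right _ hV
  have t2 : K ≤ K * Q := Nat.le_mul_of_pos_right _ hQ1
  have t3 : Q ≤ K * Q := Nat.le_mul_of_pos_left _ (by omega)
  have t4 : N' * P ≤ K * Q := Nat.mul_le_mul hK hQ
  have t5 : N' * Q ≤ K * Q := Nat.mul_le_mul_right _ hK
  have t6 : N' * N' ≤ K * Q := Nat.mul_le_mul hK (hND.trans hQ)
  have t7 : N' * V * Q ≤ Q * V * K := by
    rw [show Q * V * K = K * V * Q by ring]
    gcongr
  have t8 : N' * V ≤ N' * V * Q := Nat.le_mul_of_pos_right _ hQ1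
  have t9 : Q * V ≤ Q * V * K := Nat.le_mul_of_pos_right _ (by omega)
  linarith

theorem exists_mooreRuns (hS : OrbitFiniteNominal S) (hA : OrbitFiniteNominal A)
    (M : NominalDFA S A) {LS : List (Orb S)} {LA : List (Orb A)} (hLS : Represents LS)
    (hLA : Represents LA) :
    ∃ (out : Output S A) (t : ℕ), MooreRuns M LS LA out t ∧ IsMinimisation M out ∧
      t ≤ 200 * (3 ^ (5 * dim (S ⊕ A)) * max 1 (dim (S ⊕ A)) *
        max 1 (numOrb S) ^ 3 * max 1 (numOrb A)) := by
  set k := dim (S ⊕ A)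
  have hSk : dim S ≤ k := dim_le_dim_sum_left hS hA
  have hAk : dim A ≤ k := dim_le_dim_sum_right hS hA
  set SS := (productSet LS LS).val with hSSdef
  have hSS : Represents SS := represents_productSet hS hS hLS hLS
  obtain ⟨n, hn, hstable, hmin⟩ := M.exists_stable hS
  have hLSk : ∀ o ∈ LS, dimElt o.out ≤ k := fun o _ => (dimElt_le_dim hS _).trans hSk
  have hLAk : ∀ o ∈ LA, dimElt o.out ≤ k := fun o _ => (dimElt_le_dim hA _).trans hAk
  have hSSk : ∀ o : Orb (S × S), dimElt o.out ≤ 2 * k := fun o => by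
    have h1 := dimElt_prod_le (hS.nominal (Quotient.out o).1) (hS.nominal (Quotient.out o).2)
    have h2 := dimElt_le_dim hS (Quotient.out o).1
    have h3 := dimElt_le_dim hS (Quotient.out o).2
    rw [Prod.mk.eta] at h1
    omega
  have hSSt := productSet_time_le hLSk hLSk
  have hSSlen := length_productSet_le hLSk hLSk
  rw [← two_mul, hLS.length_eq] at hSSt hSSlen
  rw [← hSSdef] at hSSlen
  -- the states of the loop
  let f : ℕ → List (Orb (S × S)) × List (Orb (S × S)) := fun i =>
    (relList (M.approxEquiv i) SS, relList (M.approxEquiv (i + 1)) SS)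
  have htest : ∀ i, (mooreTest (f i)).val = false ↔ M.approxEquiv i = M.approxEquiv (i + 1) := by
    intro i
    have : (mooreTest (f i)).val = !(listEq (f i).2 (f i).1).val := rfl
    rw [this, Bool.not_eq_false', listEq_val]
    constructor
    · intro h
      exact (relList_injective (M.approxEquiv_equivariant _) (M.approxEquiv_equivariant _)
        hSS h).symm
    · intro h
      simp only [f]
      rw [h]
  have hbody : ∀ i, (mooreBody M LA (f i)).val = f (i + 1) := by
    intro i
    have : (mooreBody M LA (f i)).val = ((f i).2, (refine M LA (f i).2).val) := rfl
    rw [this]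
    simp only [f]
    rw [refine_val M hLA hS hA hSS]
  have hinit : (mooreInit M LS).val = f 0 := by
    have : (mooreInit M LS).val = (SS, (initialRel M SS).val) := rfl
    rw [this, initialRel_val]
    simp only [f]
    rw [relList_approxEquiv_zero]
  have hR : ∀ s t, orb (s, t) ∈ (f n).2 ↔ M.lang s = M.lang t := by
    intro s t
    simp only [f]
    rw [mem_relList (M.approxEquiv_equivariant _) hSS, ← hstable, ← M.langEquiv_eq_of_stable hstable]
    rfl
  have hRn : (f n).2.Nodup := hSS.1.filter _
  have hlen : ∀ i, (f i).2.length ≤ SS.length := fun i => length_relList_le _ _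
  -- the times of the parts
  have htinit : (mooreInit M LS).time ≤
      (1 + numOrb S * (2 + 15 * (numOrb S * 3 ^ (2 * k)))) + (1 + SS.length * 5) + 1 := by
    have h1 : (initialRel M SS).time ≤ 1 + SS.length * (4 + 1) :=
      Timed.filter_time_le fun o _ => le_rfl
    simp only [mooreInit, Timed.bind_time, Timed.one_time, ← hSSdef]
    omega
  have httest : ∀ i, (mooreTest (f i)).time ≤ 2 + SS.length * 2 := by
    intro i
    have h1 := listEq_time_le (f i).2 (f i).1
    have h2 := hlen i
    simp only [mooreTest, Timed.bind_time, Timed.one_time]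
    omega
  have htbody : ∀ i, (mooreBody M LA (f i)).time ≤
      2 + SS.length * (5 + 21 * (numOrb A * 3 ^ (3 * k))) := by
    intro i
    have h1 := refine_time_le M (f i).2 (fun o _ => hSSk o) hLAk
    have h2 := Nat.mul_le_mul_right (5 + 21 * (numOrb A * 3 ^ (3 * k))) (hlen i)
    rw [hLA.length_eq] at h1
    simp only [mooreBody, Timed.bind_time, Timed.one_time]
    omega
  obtain ⟨tl, htl, hrun⟩ := WhileRuns.exists_of_sequence n f
    (fun i hi => by
      rw [← Bool.not_eq_false, htest]
      exact hmin i hi)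
    (fun i _ => hbody i) ((htest n).2 hstable) httest htbody
  have htfin := mooreFinish_time_le (M := M) hS hLS hR hSk hLAk
  rw [hLS.length_eq, hLA.length_eq] at htfin
  refine ⟨_, _, ⟨f n, tl, hinit ▸ hrun, rfl, rfl⟩,
    isMinimisation_mooreFinish hS hA hLS hLA hRn hR, ?_⟩
  have htfin' := htfin.trans (show _ ≤
      (1 + numOrb S * (5 + SS.length + 2 * numOrb S)) + (1 + numOrb S * 3) +
      (1 + numOrb S * (2 + 15 * (numOrb A * 3 ^ (2 * k)))) +
      (1 + numOrb S * (numOrb A * 3 ^ (2 * k)) * (SS.length + 8)) + 1 by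
    have := hlen n
    gcongr)
  have hk' : 2 * (max 1 (dim S) * max 1 (numOrb S)) ≤ 2 * (max 1 k * max 1 (numOrb S)) := by
    gcongr
  have hfinal := total_time_le (le_max_left 1 (numOrb S)) (le_max_left 1 (numOrb A))
    (le_max_left 1 k) (Nat.one_le_pow (2 * k) 3 (by norm_num))
    (Nat.pow_le_pow_right (by norm_num) (by omega : 2 * k ≤ 3 * k)) (le_max_right 1 (numOrb S))
    (le_max_right 1 (numOrb A)) hSSlen (hn.trans hk')
  rw [← pow_add, show 2 * k + 3 * k = 5 * k by ring] at hfinal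
  omega

end Moore

end NominalMoore

theorem theorem8p2 :
    -- the running time, with one constant for all automata
    (∃ C : ℕ, ∀ (S : Type u) (A : Type v) [MulAction Mon S] [MulAction Mon A],
      OrbitFiniteNominal S → OrbitFiniteNominal A →
      ∀ (M : NominalDFA S A) (LS : List (Orb S)) (LA : List (Orb A)),
        Represents LS → Represents LA →
        ∃ (out : Output S A) (t : ℕ), MooreRuns M LS LA out t ∧ IsMinimisation M out ∧
          t ≤ C * (3 ^ (5 * dim (S ⊕ A)) * max 1 (dim (S ⊕ A)) *
            max 1 (numOrb S) ^ 3 * max 1 (numOrb A)))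
    ∧
    -- the length of chains of equivariant partitions
    (∃ C : ℕ, ∀ (S : Type u) [MulAction Mon S], OrbitFiniteNominal S →
      ∀ c : Set (Setoid S), (∀ r ∈ c, IsEquivariantPartition r) → IsChain (· ≤ ·) c →
        c.encard ≤ ((C * (max 1 (dim S) * max 1 (numOrb S)) : ℕ) : ℕ∞))
    ∧
    -- fixed-parameter tractability in the dimension
    (∃ (f : ℕ → ℕ) (d : ℕ), Computable f ∧
      ∀ (S : Type u) (A : Type v) [MulAction Mon S] [MulAction Mon A],
      OrbitFiniteNominal S → OrbitFiniteNominal A →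
      ∀ (M : NominalDFA S A) (LS : List (Orb S)) (LA : List (Orb A)),
        Represents LS → Represents LA →
        ∃ (out : Output S A) (t : ℕ), MooreRuns M LS LA out t ∧ IsMinimisation M out ∧
          t ≤ f (dim (S ⊕ A)) * (numOrb S + numOrb A + 1) ^ d) := by
  refine ⟨⟨200, fun S A _ _ hS hA M LS LA hLS hLA => exists_mooreRuns hS hA M hLS hLA⟩,
    ⟨3, fun S _ hS c hc hchain => encard_chain_le hS c hc hchain⟩,
    fun k => 200 * (243 ^ k * (k + 1)), 4, ?_, fun S A _ _ hS hA M LS LA hLS hLA => ?_⟩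
  · have hpow : Primrec fun k : ℕ => 243 ^ k :=
      (Primrec₂.unpaired'.1 Nat.Primrec.pow).comp (Primrec.const 243) Primrec.id
    exact (Primrec.nat_mul.comp (Primrec.const 200)
      (Primrec.nat_mul.comp hpow Primrec.succ)).to_comp
  · obtain ⟨out, t, hrun, hmin, ht⟩ := exists_mooreRuns hS hA M hLS hLA
    refine ⟨out, t, hrun, hmin, ht.trans ?_⟩
    rw [pow_mul, show 3 ^ 5 = 243 by norm_num, pow_succ (numOrb S + numOrb A + 1) 3,
      mul_assoc 200, mul_assoc (243 ^ _ * _) (max 1 (numOrb S) ^ 3)]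
    gcongr <;> omega
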